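/- A graph is a \emph{crowned graph} with head $H$ and crown $C$ if its vertex set is partitioned into $H \cup C$ such that $C$ is an independent set and there is a matching $M$ with $|M|=|H|$, every edge of which joins a vertex of $H$ to a vertex of $C$. The enumeration problem \textsc{Enum Crown} asks, given a crowned graph $G=(H\cup C,E)$ and an integer $x\in[0,|C|]$, to list all vertex covers of $G$ of size exactly $|H|+x$. \textsc{Enum Small Crown} is the special case of \textsc{Enum Crown} in which $|C|=|H|$ and $x=0$, i.e. the task of listing all vertex covers of $G$ of size $|H|$. A \emph{polynomial-delay algorithm} for an enumeration problem is an algorithm that, on every instance, halts after listing every solution exactly once and nothing else, such that the time before the first output, the time between any two consecutive outputs, and the time after the last output are bounded by a polynomial in the size of the input. \textbf{Lemma.} If \textsc{Enum Small Crown} admits a polynomial-delay algorithm, then \textsc{Enum Crown} also admits a polynomial-delay algorithm. -/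

import Mathlib

namespace PolyDelay

/-! ### The machine model

Programs of the `WHILE` language over binary trees, with a finite number of registers (those
that occur in the program), each of which holds (a pointer to) a tree.  Every instruction is a
constant-time pointer operation and every test is a test for being the empty tree; each of them
costs one time unit.  An output instruction costs the size of the tree that it writes.
Random access machines with logarithmic cost and such programs simulate each other step by step;
the overhead per step is polynomial in the lengths of the addresses and numbers involved, so the
notion of polynomial delay is the same. -/

/-- Binary trees, the data on which programs work. -/
inductive Data where
  | nil : Data
  | cons (a b : Data) : Data

namespace Data

/-- The left subtree (and `nil` for the empty tree). -/
def fst : Data → Data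
  | nil => nil
  | cons a _ => a

/-- The right subtree (and `nil` for the empty tree). -/
def snd : Data → Data
  | nil => nil
  | cons _ b => b

/-- The size of a tree: its number of nodes, the empty leaves included. -/
def size : Data → ℕ
  | nil => 1
  | cons a b => size a + size b + 1

/-- A bit as a tree. -/
def ofBool : Bool → Data
  | false => nil
  | true => cons nil nil

/-- A list of trees as a tree. -/
def ofList : List Data → Data
  | [] => nil
  | a :: l => cons a (ofList l)

/-- A natural number in unary, as a tree. -/
def ofNat (n : ℕ) : Data := ofList (List.replicate n nil)

end Data

/-- Programs.  The registers are numbered by natural numbers. -/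
inductive Cmd where
  /-- `x := nil` -/
  | setNil (x : ℕ) : Cmd
  /-- `x := y` -/
  | copy (x y : ℕ) : Cmd
  /-- `x := cons y z` -/
  | pair (x y z : ℕ) : Cmd
  /-- `x := fst y` -/
  | left (x y : ℕ) : Cmd
  /-- `x := snd y` -/
  | right (x y : ℕ) : Cmd
  /-- output the content of `x` -/
  | output (x : ℕ) : Cmd
  /-- `c₁; c₂` -/
  | seq (c₁ c₂ : Cmd) : Cmd
  /-- if `x` is not `nil` then `c₁` else `c₂` -/
  | ite (x : ℕ) (c₁ c₂ : Cmd) : Cmd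
  /-- as long as `x` is not `nil`, do `c` -/
  | loop (x : ℕ) (c : Cmd) : Cmd

/-- The contents of all registers. -/
abbrev Store := ℕ → Data

/-- The course of a run in time: `none` is a time unit that passes, and `some d` is the moment
at which the output of `d` is completed. -/
abbrev Trace := List (Option Data)

/-- `Run c σ σ' t`: started with the register contents `σ`, the program `c` halts with the
register contents `σ'`, and `t` is the trace of the run. -/
inductive Run : Cmd → Store → Store → Trace → Prop
  | setNil (σ : Store) (x : ℕ) :
      Run (.setNil x) σ (Function.update σ x .nil) [none]
  | copy (σ : Store) (x y : ℕ) :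
      Run (.copy x y) σ (Function.update σ x (σ y)) [none]
  | pair (σ : Store) (x y z : ℕ) :
      Run (.pair x y z) σ (Function.update σ x (.cons (σ y) (σ z))) [none]
  | left (σ : Store) (x y : ℕ) :
      Run (.left x y) σ (Function.update σ x (σ y).fst) [none]
  | right (σ : Store) (x y : ℕ) :
      Run (.right x y) σ (Function.update σ x (σ y).snd) [none]
  | output (σ : Store) (x : ℕ) :
      Run (.output x) σ σ (List.replicate (σ x).size none ++ [some (σ x)])
  | seq {c₁ c₂ : Cmd} {σ₁ σ₂ σ₃ : Store} {t₁ t₂ : Trace} :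
      Run c₁ σ₁ σ₂ t₁ → Run c₂ σ₂ σ₃ t₂ → Run (.seq c₁ c₂) σ₁ σ₃ (t₁ ++ t₂)
  | ite_true {x : ℕ} {c₁ c₂ : Cmd} {σ σ' : Store} {t : Trace} :
      σ x ≠ .nil → Run c₁ σ σ' t → Run (.ite x c₁ c₂) σ σ' (none :: t)
  | ite_false {x : ℕ} {c₁ c₂ : Cmd} {σ σ' : Store} {t : Trace} :
      σ x = .nil → Run c₂ σ σ' t → Run (.ite x c₁ c₂) σ σ' (none :: t)
  | loop_true {x : ℕ} {c : Cmd} {σ₁ σ₂ σ₃ : Store} {t₁ t₂ : Trace} :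
      σ₁ x ≠ .nil → Run c σ₁ σ₂ t₁ → Run (.loop x c) σ₂ σ₃ t₂ →
        Run (.loop x c) σ₁ σ₃ (none :: (t₁ ++ t₂))
  | loop_false {x : ℕ} {c : Cmd} {σ : Store} :
      σ x = .nil → Run (.loop x c) σ σ [none]

/-- At the start register `0` holds the input, and all other registers are empty. -/
def initStore (d : Data) : Store := Function.update (fun _ => .nil) 0 d

/-- The outputs of a run, in the order in which they are written. -/
def outputs (t : Trace) : List Data := t.filterMap id

/-- No period without an output lasts longer than `b` time units: neither the one before the first
output, nor the one between two consecutive outputs, nor the one after the last output. -/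
def DelayAtMost (t : Trace) (b : ℕ) : Prop :=
  ∀ s : Trace, s <:+: t → (∀ e ∈ s, e = none) → s.length ≤ b

/-! ### Enumeration problems -/

/-- An enumeration problem: its instances with their encoding, and for each instance the set of
the (encoded) solutions that have to be listed. -/
structure EnumProblem where
  Instance : Type
  encode : Instance → Data
  Sol : Instance → Set Data

/-- The problem has a polynomial-delay algorithm: a program that, on every instance, halts after
it has listed all the solutions without repetition and nothing else, such that the times before
the first output, between consecutive outputs and after the last output are bounded by a
polynomial in the size of the input. -/
def EnumProblem.AdmitsPolyDelay (P : EnumProblem) : Prop :=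
  ∃ (c : Cmd) (p : Polynomial ℕ), ∀ i : P.Instance, ∃ (σ : Store) (t : Trace),
    Run c (initStore (P.encode i)) σ t ∧
    (outputs t).Nodup ∧
    (∀ d, d ∈ outputs t ↔ d ∈ P.Sol i) ∧
    DelayAtMost t (p.eval (P.encode i).size)

/-! ### Crowned graphs -/

/-- `G` is a crowned graph with head `H` and crown `C`: these two sets partition the vertex set,
`C` is independent, and there is a matching of size `|H|` all of whose edges join `H` to `C`. -/
def IsCrowned {V : Type*} [Fintype V] [DecidableEq V] (G : SimpleGraph V) (H C : Finset V) :
    Prop :=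
  Disjoint H C ∧ H ∪ C = Finset.univ ∧ G.IsIndepSet (C : Set V) ∧
    ∃ M : G.Subgraph, M.IsMatching ∧
      (∀ u v, M.Adj u v → (u ∈ H ∧ v ∈ C) ∨ (u ∈ C ∧ v ∈ H)) ∧
      M.edgeSet.ncard = H.card

/-- The instances of Enum Crown: a crowned graph, given with its head and its crown, and an
integer `x` in `[0, |C|]`. -/
structure CrownInstance where
  n : ℕ
  G : SimpleGraph (Fin n)
  head : Finset (Fin n)
  crown : Finset (Fin n)
  crowned : IsCrowned G head crown
  x : ℕ
  x_le : x ≤ crown.card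

/-- A set of vertices, encoded as its list of membership bits. -/
def encodeSet {n : ℕ} (S : Finset (Fin n)) : Data :=
  Data.ofList (List.ofFn fun v => Data.ofBool (decide (v ∈ S)))

open Classical in
/-- A graph, encoded as its adjacency matrix. -/
noncomputable def encodeGraph {n : ℕ} (G : SimpleGraph (Fin n)) : Data :=
  Data.ofList (List.ofFn fun v =>
    Data.ofList (List.ofFn fun w => Data.ofBool (decide (G.Adj v w))))

/-- The encoding of an instance: the number `x` in unary, the head, the crown and the graph. -/
noncomputable def CrownInstance.encode (I : CrownInstance) : Data :=
  Data.ofList [Data.ofNat I.x, encodeSet I.head, encodeSet I.crown, encodeGraph I.G]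

/-- The solutions of an instance: the vertex covers of size exactly `|H| + x`. -/
def CrownInstance.Sol (I : CrownInstance) : Set (Finset (Fin I.n)) :=
  {S | I.G.IsVertexCover (S : Set (Fin I.n)) ∧ S.card = I.head.card + I.x}

/-- Enum Crown. -/
noncomputable def enumCrown : EnumProblem where
  Instance := CrownInstance
  encode I := I.encode
  Sol I := encodeSet '' I.Sol

/-- Enum Small Crown: the special case of Enum Crown in which `|C| = |H|` and `x = 0`. -/
noncomputable def enumSmallCrown : EnumProblem where
  Instance := {I : CrownInstance // I.crown.card = I.head.card ∧ I.x = 0}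
  encode I := I.1.encode
  Sol I := encodeSet '' I.1.Sol

end PolyDelay

namespace PolyDelay
open List

/-! Fix a matching of all heads into the crown. For a vertex cover `S`, call a crown vertex of `S` a
defect if it is unmatched or if its matched head lies in `S` as well. Every matching edge has an end
in `S`, so `|S|` is `|H|` plus the number of defects (`card_of_cover`). The covers of size `|H| + x`
are therefore the disjoint union, over the `x`-subsets `D` of `C`, of the classes of covers with
defect set exactly `D`. No class is empty, since `H ∪ D` belongs to it (`exists_fits_of_choice`).

For fixed `D`, the class is the solution set of a 2-CNF formula. The variable of a vertex `v` says
that `v ∈ S \ D`, and the clauses express that edges are covered, that the head matched to a vertex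
of `D` is in `S`, and that no crown vertex outside `D` is a defect. Take the literals as vertices
and the clauses as edges, and join each variable to its negation. The vertex covers with as many
elements as there are variables are then the satisfying assignments. Each edge has an end among the
positive literals of heads and the negative literals of all other variables. So the graph is crowned
with crown as large as head, and its minimum covers are an instance of Enum Small Crown
(`State.isCrowned`, `State.encodeSet_image_sol`).

The algorithm runs through the sets `D` in lexicographic order (`steps_choices`) and calls the given
algorithm on each gadget, translating every output. As each call outputs something, no silent period
spans more than two calls. The matching is not part of the input; it is computed by an auction
(`auction_spec`).

On the machine side, `PolyTime` is a class of functions with enough closure properties to contain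
all these constructions, and `EnumProblem.AdmitsPolyDelay.reduce` is the general principle for
enumerating by a sequence of calls. -/

/-- Types whose elements are encoded as trees. -/
class Enc (α : Type) where
  enc : α → Data

open Enc

instance : Enc Unit := ⟨fun _ => .nil⟩
instance : Enc Bool := ⟨Data.ofBool⟩
instance : Enc ℕ := ⟨Data.ofNat⟩
instance {α β : Type} [Enc α] [Enc β] : Enc (α × β) := ⟨fun a => .cons (enc a.1) (enc a.2)⟩
instance {α : Type} [Enc α] : Enc (List α) := ⟨fun l => Data.ofList (l.map enc)⟩
instance {α : Type} [Enc α] : Enc (Option α) :=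
  ⟨fun o => o.elim .nil fun a => .cons (enc a) .nil⟩

/-- The size of the encoding. -/
def sz {α : Type} [Enc α] (a : α) : ℕ := (enc a).size

/-- A run without outputs that takes `m` time units. -/
abbrev Silent (c : Cmd) (σ σ' : Store) (m : ℕ) : Prop := Run c σ σ' (replicate m none)

/-- The function is computed by a program in polynomial time: for each `b` there is one that reads
its argument from register `b`, leaves the value there, and does not change the registers
below `b`. -/
@[fun_prop]
def PolyTime {α β : Type} [Enc α] [Enc β] (f : α → β) : Prop :=
  (∃ q : Polynomial ℕ, ∀ a, sz (f a) ≤ q.eval (sz a)) ∧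
  ∀ b : ℕ, ∃ (c : Cmd) (p : Polynomial ℕ), ∀ (a : α) (σ : Store), σ b = enc a →
    ∃ (σ' : Store) (m : ℕ), Silent c σ σ' m ∧ m ≤ p.eval (sz a) ∧ σ' b = enc (f a) ∧
      ∀ r < b, σ' r = σ r

theorem Silent.seq {c₁ c₂ : Cmd} {σ₁ σ₂ σ₃ : Store} {m k : ℕ} (h₁ : Silent c₁ σ₁ σ₂ m)
    (h₂ : Silent c₂ σ₂ σ₃ k) : Silent (.seq c₁ c₂) σ₁ σ₃ (m + k) := by
  unfold Silent at *
  rw [replicate_add]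
  exact .seq h₁ h₂

theorem eval_mono (p : Polynomial ℕ) {m n : ℕ} (h : m ≤ n) : p.eval m ≤ p.eval n := by
  induction p using Polynomial.induction_on' with
  | add p q hp hq => simpa using add_le_add hp hq
  | monomial k a => simpa using Nat.mul_le_mul_left a (Nat.pow_le_pow_left h k)

/-- Proofs leave no trace in the encoding, so a branch of a case distinction can be treated as a
function defined only where its condition holds. -/
instance {α : Type} [Enc α] {p : α → Prop} : Enc {a : α // p a} := ⟨fun a => enc a.1⟩

/-! ### Sizes of encodings -/

section Sizes
variable {α β : Type} [Enc α] [Enc β]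

theorem sz_pos (a : α) : 0 < sz a := by
  unfold sz; cases enc a <;> simp [Data.size]

@[simp] theorem sz_pair (a : α) (b : β) : sz (a, b) = sz a + sz b + 1 := rfl
@[simp] theorem sz_nil : sz ([] : List α) = 1 := rfl
@[simp] theorem sz_cons (a : α) (l : List α) : sz (a :: l) = sz a + sz l + 1 := rfl
@[simp] theorem sz_none : sz (none : Option α) = 1 := rfl
@[simp] theorem sz_some (a : α) : sz (some a) = sz a + 2 := rfl
theorem sz_subtype {p : α → Prop} (a : {a : α // p a}) : sz a = sz a.1 := rfl
@[simp] theorem sz_unit (a : Unit) : sz a = 1 := rfl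

/-- Numbers are unary, hence the same trees as lists of units; this turns arithmetic into list
processing. -/
theorem enc_nat (n : ℕ) : enc n = enc (replicate n ()) := by
  change Data.ofNat n = Data.ofList _
  simp [Data.ofNat, enc]

@[simp] theorem sz_nat (n : ℕ) : sz n = 2 * n + 1 := by
  unfold sz
  rw [enc_nat]
  change sz (replicate n ()) = _
  induction n with
  | zero => rfl
  | succ n ih => simp [replicate_succ, ih]; omega

theorem sz_bool_le (b : Bool) : sz b ≤ 3 := by cases b <;> decide

theorem sz_list (l : List α) : sz l = (l.map fun a => sz a + 1).sum + 1 := by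
  induction l with
  | nil => rfl
  | cons a l ih => simp [ih]; omega

@[simp] theorem enc_bool_eq_nil (b : Bool) : enc b = .nil ↔ b = false := by
  cases b <;> simp [enc, Data.ofBool]

@[simp] theorem enc_option_eq_nil (o : Option α) : enc o = .nil ↔ o = none := by
  cases o <;> simp [enc]

@[simp] theorem enc_list_eq_nil (l : List α) : enc l = .nil ↔ l = [] := by
  cases l <;> simp [enc, Data.ofList]

theorem sz_append (l l' : List α) : sz (l ++ l') + 1 = sz l + sz l' := by
  simp [sz_list]; omega

theorem sz_le_of_mem {a : α} {l : List α} (h : a ∈ l) : sz a ≤ sz l := by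
  induction l with
  | nil => simp at h
  | cons b l ih => rcases mem_cons.1 h with rfl | h <;> simp <;> have := ih <;> grind

theorem length_le_sz (l : List α) : l.length ≤ sz l := by
  induction l with
  | nil => simp
  | cons b l ih => simp; omega

theorem sz_le_of_forall {l : List α} {n : ℕ} (h : ∀ a ∈ l, sz a ≤ n) :
    sz l ≤ l.length * (n + 1) + 1 := by
  induction l with
  | nil => simp
  | cons b l ih =>
    have h₁ := h b (by simp)
    have h₂ := ih fun a ha => h a (by simp [ha])
    simp [add_mul]; omega

end Sizes

/-! ### Basic closure properties of polynomial-time functions -/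

namespace PolyTime
variable {α β γ δ : Type} [Enc α] [Enc β] [Enc γ] [Enc δ]

theorem size_bound {f : α → β} (hf : PolyTime f) :
    ∃ q : Polynomial ℕ, ∀ a, sz (f a) ≤ q.eval (sz a) := hf.1

/-- A function that is computed on encodings by a single instruction. -/
theorem of_instr {f : α → β} (q : Polynomial ℕ) (hq : ∀ a, sz (f a) ≤ q.eval (sz a))
    (c : ℕ → Cmd) (hc : ∀ b a σ, σ b = enc a → ∃ d, d = enc (f a) ∧
      Run (c b) σ (Function.update σ b d) [none]) : PolyTime f := by
  refine ⟨⟨q, hq⟩, fun b => ⟨c b, 1, fun a σ h => ?_⟩⟩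
  obtain ⟨d, rfl, h⟩ := hc b a σ h
  refine ⟨_, 1, h, by simp, by simp, fun r hr => ?_⟩
  simp [hr.ne]

/-- Functions that do not change the encoding. -/
theorem of_enc_eq {f : α → β} (h : ∀ a, enc (f a) = enc a) : PolyTime f :=
  of_instr .X (fun a => by simp [sz, h]) (fun b => .copy b b)
    fun b a σ hb => ⟨_, by rw [h, hb], .copy σ b b⟩

@[fun_prop]
theorem id : PolyTime (fun a : α => a) := of_enc_eq fun _ => rfl

@[fun_prop]
theorem comp {g : β → γ} {f : α → β} (hg : PolyTime g) (hf : PolyTime f) :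
    PolyTime (fun a => g (f a)) := by
  obtain ⟨⟨q₁, hq₁⟩, hf⟩ := hf
  obtain ⟨⟨q₂, hq₂⟩, hg⟩ := hg
  refine ⟨⟨q₂.comp q₁, fun a => ?_⟩, fun b => ?_⟩
  · rw [Polynomial.eval_comp]
    exact (hq₂ _).trans (eval_mono _ (hq₁ a))
  · obtain ⟨c₁, p₁, h₁⟩ := hf b
    obtain ⟨c₂, p₂, h₂⟩ := hg b
    refine ⟨.seq c₁ c₂, p₁ + p₂.comp q₁, fun a σ hσ => ?_⟩
    obtain ⟨σ₁, m₁, r₁, l₁, e₁, k₁⟩ := h₁ a σ hσ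
    obtain ⟨σ₂, m₂, r₂, l₂, e₂, k₂⟩ := h₂ _ σ₁ e₁
    refine ⟨σ₂, _, r₁.seq r₂, ?_, e₂, fun r hr => (k₂ r hr).trans (k₁ r hr)⟩
    rw [Polynomial.eval_add, Polynomial.eval_comp]
    exact add_le_add l₁ (l₂.trans (eval_mono _ (hq₁ a)))

theorem of_eq {f g : α → β} (hf : PolyTime f) (h : ∀ a, f a = g a) : PolyTime g :=
  (funext h : f = g) ▸ hf

@[fun_prop]
theorem prodMk {f : α → β} {g : α → γ} (hf : PolyTime f) (hg : PolyTime g) :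
    PolyTime (fun a => (f a, g a)) := by
  obtain ⟨⟨q₁, hq₁⟩, hf⟩ := hf
  obtain ⟨⟨q₂, hq₂⟩, hg⟩ := hg
  refine ⟨⟨q₁ + q₂ + 1, fun a => ?_⟩, fun b => ?_⟩
  · simpa using add_le_add (hq₁ a) (hq₂ a)
  · obtain ⟨c₁, p₁, h₁⟩ := hf (b + 1)
    obtain ⟨c₂, p₂, h₂⟩ := hg (b + 2)
    -- Register `b` keeps the argument until the end. The two values are computed in `b + 1` and `b
    -- + 2` by programs that respect all lower registers, so neither destroys what is still needed.
    refine ⟨.seq (.seq (.copy (b + 1) b) c₁) (.seq (.seq (.copy (b + 2) b) c₂)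
      (.pair b (b + 1) (b + 2))), p₁ + p₂ + 3, fun a σ hσ => ?_⟩
    have s₁ : Silent _ _ _ 1 := Run.copy σ (b + 1) b
    obtain ⟨σ₁, m₁, r₁, l₁, e₁, k₁⟩ := h₁ a _
      (show Function.update σ (b + 1) (σ b) (b + 1) = _ by simp [hσ])
    have s₂ : Silent _ _ _ 1 := Run.copy σ₁ (b + 2) b
    obtain ⟨σ₂, m₂, r₂, l₂, e₂, k₂⟩ := h₂ a _
      (show Function.update σ₁ (b + 2) (σ₁ b) (b + 2) = _ by
        simp [k₁ b (by omega), hσ])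
    have s₃ : Silent _ _ _ 1 := Run.pair σ₂ b (b + 1) (b + 2)
    refine ⟨_, _, (s₁.seq r₁).seq ((s₂.seq r₂).seq s₃), ?_, ?_, ?_⟩
    · simp only [Polynomial.eval_add, Polynomial.eval_ofNat]; omega
    · simp [e₂, k₂ (b + 1) (by omega), e₁, enc]
    · intro r hr
      rw [Function.update_of_ne (by omega), k₂ r (by omega), Function.update_of_ne (by omega),
        k₁ r (by omega), Function.update_of_ne (by omega)]

theorem fst' : PolyTime (fun a : α × β => a.1) :=
  of_instr .X (fun a => by rcases a with ⟨a, b⟩; simp; omega) (fun b => .left b b)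
    fun b a σ hb => ⟨_, by rw [hb]; rfl, .left σ b b⟩

theorem snd' : PolyTime (fun a : α × β => a.2) :=
  of_instr .X (fun a => by rcases a with ⟨a, b⟩; simp; omega) (fun b => .right b b)
    fun b a σ hb => ⟨_, by rw [hb]; rfl, .right σ b b⟩

@[fun_prop]
theorem fst {f : α → β × γ} (hf : PolyTime f) : PolyTime (fun a => (f a).1) := fst'.comp hf

@[fun_prop]
theorem snd {f : α → β × γ} (hf : PolyTime f) : PolyTime (fun a => (f a).2) := snd'.comp hf

theorem unit : PolyTime (fun _ : α => ()) :=
  of_instr 1 (fun a => by simp) (fun b => .setNil b)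
    fun b a σ hb => ⟨_, rfl, .setNil σ b⟩

@[fun_prop]
theorem const (x : β) : PolyTime (fun _ : α => x) := by
  -- A fixed tree is assembled by a fixed sequence of instructions, so the time does not depend on
  -- the argument.
  suffices h : ∀ d : Data, ∀ b, ∃ (c : Cmd) (m : ℕ), ∀ σ : Store, ∃ σ' : Store,
      Silent c σ σ' m ∧ σ' b = d ∧ ∀ r < b, σ' r = σ r by
    refine ⟨⟨Polynomial.C (sz x), fun a => by simp⟩, fun b => ?_⟩
    obtain ⟨c, m, h⟩ := h (enc x) b
    refine ⟨c, Polynomial.C m, fun a σ _ => ?_⟩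
    obtain ⟨σ', h₁, h₂, h₃⟩ := h σ
    exact ⟨σ', m, h₁, by simp, h₂, h₃⟩
  intro d
  induction d with
  | nil =>
    exact fun b => ⟨.setNil b, 1, fun σ => ⟨_, Run.setNil σ b, by simp,
      fun r hr => by simp [hr.ne]⟩⟩
  | cons d₁ d₂ ih₁ ih₂ =>
    intro b
    obtain ⟨c₁, m₁, h₁⟩ := ih₁ (b + 1)
    obtain ⟨c₂, m₂, h₂⟩ := ih₂ (b + 2)
    refine ⟨.seq c₁ (.seq c₂ (.pair b (b + 1) (b + 2))), m₁ + (m₂ + 1), fun σ => ?_⟩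
    obtain ⟨σ₁, r₁, e₁, k₁⟩ := h₁ σ
    obtain ⟨σ₂, r₂, e₂, k₂⟩ := h₂ σ₁
    have s₃ : Silent _ _ _ 1 := Run.pair σ₂ b (b + 1) (b + 2)
    refine ⟨_, r₁.seq (r₂.seq s₃), by simp [e₂, k₂ (b + 1) (by omega), e₁], fun r hr => ?_⟩
    rw [Function.update_of_ne (by omega), k₂ r (by omega), k₁ r (by omega)]

/-- Branching on whether an encoding is the empty tree. -/
theorem of_branch {s : α → γ} {k : α → β} (hs : PolyTime s)
    (hf : PolyTime (fun a : {a : α // enc (s a) ≠ .nil} => k a))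
    (hg : PolyTime (fun a : {a : α // enc (s a) = .nil} => k a)) : PolyTime k := by
  obtain ⟨-, hs⟩ := hs
  obtain ⟨⟨q₁, hq₁⟩, hf⟩ := hf
  obtain ⟨⟨q₂, hq₂⟩, hg⟩ := hg
  refine ⟨⟨q₁ + q₂, fun a => ?_⟩, fun b => ?_⟩
  · simp only [Polynomial.eval_add]
    by_cases h : enc (s a) = .nil
    · exact (hq₂ ⟨a, h⟩).trans (by simp [sz_subtype])
    · exact (hq₁ ⟨a, h⟩).trans (by simp [sz_subtype])
  · obtain ⟨c₀, p₀, hc₀⟩ := hs (b + 1)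
    obtain ⟨c₁, p₁, hc₁⟩ := hf b
    obtain ⟨c₂, p₂, hc₂⟩ := hg b
    refine ⟨.seq (.copy (b + 1) b) (.seq c₀ (.ite (b + 1) c₁ c₂)), p₀ + p₁ + p₂ + 2,
      fun a σ hσ => ?_⟩
    have s₁ : Silent _ _ _ 1 := Run.copy σ (b + 1) b
    obtain ⟨σ₁, m₁, r₁, l₁, e₁, k₁⟩ := hc₀ a _
      (show Function.update σ (b + 1) (σ b) (b + 1) = _ by simp [hσ])
    have hb : σ₁ b = enc a := by rw [k₁ b (by omega), Function.update_of_ne (by omega), hσ]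
    have hlow : ∀ r < b, σ₁ r = σ r := fun r hr => by
      rw [k₁ r (by omega), Function.update_of_ne (by omega)]
    simp only [Polynomial.eval_add, Polynomial.eval_ofNat]
    by_cases h : enc (s a) = .nil
    · obtain ⟨σ₂, m₂, r₂, l₂, e₂, k₂⟩ := hc₂ ⟨a, h⟩ σ₁ hb
      have s₂ : Silent (.ite (b + 1) c₁ c₂) σ₁ σ₂ (m₂ + 1) := .ite_false (e₁.trans h) r₂
      simp only [sz_subtype] at l₂
      exact ⟨σ₂, _, s₁.seq (r₁.seq s₂), by omega, e₂, fun r hr => (k₂ r hr).trans (hlow r hr)⟩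
    · obtain ⟨σ₂, m₂, r₂, l₂, e₂, k₂⟩ := hc₁ ⟨a, h⟩ σ₁ hb
      have s₂ : Silent (.ite (b + 1) c₁ c₂) σ₁ σ₂ (m₂ + 1) := .ite_true (e₁ ▸ h) r₂
      simp only [sz_subtype] at l₂
      exact ⟨σ₂, _, s₁.seq (r₁.seq s₂), by omega, e₂, fun r hr => (k₂ r hr).trans (hlow r hr)⟩

@[fun_prop]
theorem subtypeVal {p : α → Prop} : PolyTime (fun a : {a : α // p a} => a.1) :=
  of_enc_eq fun _ => rfl

theorem subtypeMk {p : β → Prop} {f : α → β} (hf : PolyTime f) (hp : ∀ a, p (f a)) :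
    PolyTime (fun a => (⟨f a, hp a⟩ : {b : β // p b})) := hf

@[fun_prop]
theorem cond {s : α → Bool} {f g : α → β} (hs : PolyTime s) (hf : PolyTime f)
    (hg : PolyTime g) : PolyTime (fun a => bif s a then f a else g a) := by
  refine of_branch hs ((hf.comp subtypeVal).of_eq fun a => ?_)
    ((hg.comp subtypeVal).of_eq fun a => ?_)
  · have h := a.2
    rw [ne_eq, enc_bool_eq_nil, Bool.not_eq_false] at h
    simp [h]
  · simp [(enc_bool_eq_nil _).1 a.2]

-- `some x` and the pair `(x, ())` are the same tree.
@[fun_prop]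
theorem some {f : α → β} (hf : PolyTime f) : PolyTime (fun a => Option.some (f a)) :=
  (of_enc_eq (f := fun p : β × Unit => Option.some p.1) fun _ => rfl).comp (hf.prodMk unit)

-- A nonempty list is the same tree as the pair of its head and its tail.
@[fun_prop]
theorem cons {f : α → β} {l : α → List β} (hf : PolyTime f) (hl : PolyTime l) :
    PolyTime (fun a => f a :: l a) :=
  (of_enc_eq (f := fun p : β × List β => p.1 :: p.2) fun _ => rfl).comp (hf.prodMk hl)

theorem optionElim {s : α → Option γ} {f : α → γ → β} {g : α → β} (hs : PolyTime s)
    (hf : PolyTime (fun q : α × γ => f q.1 q.2)) (hg : PolyTime g) :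
    PolyTime (fun a => (s a).elim (g a) (f a)) := by
  refine of_branch hs ?_ ((hg.comp subtypeVal).of_eq fun a => ?_)
  · have hne : ∀ a : {a : α // enc (s a) ≠ .nil}, (s a).isSome := by
      rintro ⟨a, h⟩; simpa [Option.isSome_iff_ne_none] using h
    -- On nonempty options, extracting the element is the single instruction `left`.
    have h₁ : PolyTime (fun o : {o : Option γ // o.isSome} => o.1.get o.2) := by
      refine of_instr .X (fun a => ?_) (fun b => .left b b)
        (fun b a σ hb => ⟨(σ b).fst, ?_, .left σ b b⟩) <;> rcases a with ⟨_ | a, h⟩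
      · simp at h
      · simp [sz_subtype]
      · simp at h
      · rw [hb]; rfl
    have h₂ := h₁.comp (subtypeMk (p := fun o => o.isSome) (hs.comp subtypeVal) hne)
    refine (hf.comp (subtypeVal.prodMk h₂)).of_eq fun a => ?_
    obtain ⟨c, hc⟩ := Option.isSome_iff_exists.1 (hne a)
    simp [hc]
  · simp [(enc_option_eq_nil _).1 a.2]

theorem tail' : PolyTime (fun l : List α => l.tail) := by
  refine of_instr .X (fun l => ?_) (fun b => .right b b)
    fun b l σ hb => ⟨(σ b).snd, ?_, .right σ b b⟩
  · cases l <;> simp; omega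
  · rw [hb]; cases l <;> rfl

@[fun_prop]
theorem tail {l : α → List β} (hl : PolyTime l) : PolyTime (fun a => (l a).tail) :=
  tail'.comp hl

@[fun_prop]
theorem head? {l : α → List β} (hl : PolyTime l) : PolyTime (fun a => (l a).head?) := by
  suffices h : PolyTime (fun l : List β => l.head?) from h.comp hl
  refine of_branch id ?_ ((const none).of_eq ?_)
  · have h₁ : PolyTime (fun l : {l : List β // enc l ≠ .nil} => l.1.head (by
        rintro h; have := l.2; simp [h] at this)) := by
      refine of_instr .X (fun a => ?_) (fun b => .left b b)
        (fun b a σ hb => ⟨(σ b).fst, ?_, .left σ b b⟩) <;> rcases a with ⟨_ | a, h⟩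
      · simp at h
      · simp [sz_subtype]; omega
      · simp at h
      · rw [hb]; rfl
    exact h₁.some.of_eq fun a => (head?_eq_some_head _).symm
  · rintro ⟨l, h⟩
    simp [(enc_list_eq_nil l).1 h]

/-- Iteration along a list, if the intermediate results stay small. -/
theorem foldl {l : α → List γ} {i : α → δ} {f : α → δ → γ → δ} (hl : PolyTime l)
    (hi : PolyTime i) (hf : PolyTime (fun q : α × δ × γ => f q.1 q.2.1 q.2.2))
    (hb : ∃ q : Polynomial ℕ, ∀ a l', l' <+: l a →
      sz (l'.foldl (f a) (i a)) ≤ q.eval (sz a)) :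
    PolyTime (fun a => (l a).foldl (f a) (i a)) := by
  obtain ⟨q, hq⟩ := hb
  obtain ⟨⟨ql, hql⟩, hl⟩ := hl
  obtain ⟨-, hi⟩ := hi
  obtain ⟨-, hf⟩ := hf
  refine ⟨⟨q, fun a => hq a _ (prefix_refl _)⟩, fun b => ?_⟩
  obtain ⟨c₁, p₁, h₁⟩ := hl (b + 1)
  obtain ⟨c₂, p₂, h₂⟩ := hi (b + 2)
  obtain ⟨c₃, p₃, h₃⟩ := hf (b + 3)
  -- The body assembles the triple of argument, accumulator and list element in `b + 3`, applies the
  -- step there, stores the result in `b + 2` and advances the list in `b + 1`.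
  let body : Cmd := .seq (.left (b + 3) (b + 1)) (.seq (.pair (b + 3) (b + 2) (b + 3))
    (.seq (.pair (b + 3) b (b + 3)) (.seq c₃ (.seq (.copy (b + 2) (b + 3))
      (.right (b + 1) (b + 1))))))
  -- The triple has size at most that of argument, accumulator and element plus two pair nodes; the
  -- `6` counts five instructions and the loop test.
  let T : Polynomial ℕ := p₃.comp (.X + q + ql + 2) + 6
  -- Loop invariant: `b` holds the argument, `b + 1` the remaining list, `b + 2` the fold over the
  -- part `l₁` already read.
  have hloop : ∀ a (l₂ l₁ : List γ) (σ : Store), l a = l₁ ++ l₂ → σ b = enc a →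
      σ (b + 1) = enc l₂ → σ (b + 2) = enc (l₁.foldl (f a) (i a)) →
      ∃ σ' m, Silent (.loop (b + 1) body) σ σ' m ∧ m ≤ l₂.length * T.eval (sz a) + 1 ∧
        σ' (b + 2) = enc ((l a).foldl (f a) (i a)) ∧ ∀ r < b, σ' r = σ r := by
    intro a l₂
    induction l₂ with
    | nil =>
      intro l₁ σ hl e₀ e₁ e₂
      exact ⟨σ, 1, Run.loop_false e₁, by simp, by rw [e₂, hl, append_nil], fun _ _ => rfl⟩
    | cons x l₂ ih =>
      intro l₁ σ hl e₀ e₁ e₂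
      have s₁ : Silent _ _ _ 1 := Run.left σ (b + 3) (b + 1)
      set σ₁ := Function.update σ (b + 3) (σ (b + 1)).fst with hσ₁
      have s₂ : Silent _ _ _ 1 := Run.pair σ₁ (b + 3) (b + 2) (b + 3)
      set σ₂ := Function.update σ₁ (b + 3) (.cons (σ₁ (b + 2)) (σ₁ (b + 3))) with hσ₂
      have s₃ : Silent _ _ _ 1 := Run.pair σ₂ (b + 3) b (b + 3)
      set σ₃ := Function.update σ₂ (b + 3) (.cons (σ₂ b) (σ₂ (b + 3))) with hσ₃
      obtain ⟨σ₄, m₄, s₄, l₄, e₄, k₄⟩ := h₃ (a, l₁.foldl (f a) (i a), x) σ₃ (by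
        simp [hσ₃, hσ₂, hσ₁, e₀, e₁, e₂]; rfl)
      have s₅ : Silent _ _ _ 1 := Run.copy σ₄ (b + 2) (b + 3)
      set σ₅ := Function.update σ₄ (b + 2) (σ₄ (b + 3)) with hσ₅
      have s₆ : Silent _ _ _ 1 := Run.right σ₅ (b + 1) (b + 1)
      set σ₆ := Function.update σ₅ (b + 1) (σ₅ (b + 1)).snd with hσ₆
      have hlow : ∀ r < b + 3, σ₄ r = σ r := fun r hr => by
        rw [k₄ r hr, hσ₃, hσ₂, hσ₁]
        repeat rw [Function.update_of_ne (by omega)]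
      obtain ⟨σ₇, m₇, s₇, l₇, e₇, k₇⟩ := ih (l₁ ++ [x]) σ₆ (by simp [hl])
        (by simp [hσ₆, hσ₅, hlow, e₀]) (by simp [hσ₆, hσ₅, hlow, e₁]; rfl)
        (by simp [hσ₆, hσ₅, e₄])
      have s₈ : Silent (.loop (b + 1) body) σ σ₇ (1 + (1 + (1 + (1 + (m₄ + (1 + 1)))) + m₇)) := by
        have := Run.loop_true (by rw [e₁]; simp [enc, Data.ofList])
          (s₁.seq (s₂.seq (s₃.seq (s₄.seq (s₅.seq s₆))))) s₇
        rw [← replicate_add, ← replicate_succ] at this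
        unfold Silent
        convert this using 2
        omega
      refine ⟨σ₇, _, s₈, ?_, e₇, fun r hr => ?_⟩
      · have hm : m₄ ≤ p₃.eval (sz a + q.eval (sz a) + ql.eval (sz a) + 2) := by
          refine l₄.trans (eval_mono _ ?_)
          have := hq a l₁ (hl ▸ prefix_append _ _)
          have : sz x ≤ sz (l a) := sz_le_of_mem (by simp [hl])
          have := hql a
          simp only [sz_pair]
          omega
        simp only [T, Polynomial.eval_add, Polynomial.eval_comp, Polynomial.eval_X,
          Polynomial.eval_ofNat, length_cons, add_mul, one_mul] at l₇ ⊢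
        omega
      · rw [k₇ r hr, hσ₆, hσ₅, Function.update_of_ne (by omega), Function.update_of_ne (by omega),
          hlow r (by omega)]
  refine ⟨.seq (.seq (.copy (b + 1) b) c₁) (.seq (.seq (.copy (b + 2) b) c₂)
    (.seq (.loop (b + 1) body) (.copy b (b + 2)))), p₁ + p₂ + ql * T + 4, fun a σ hσ => ?_⟩
  have s₁ : Silent _ _ _ 1 := Run.copy σ (b + 1) b
  obtain ⟨σ₁, m₁, r₁, l₁, e₁, k₁⟩ := h₁ a _
    (show Function.update σ (b + 1) (σ b) (b + 1) = _ by simp [hσ])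
  have s₂ : Silent _ _ _ 1 := Run.copy σ₁ (b + 2) b
  obtain ⟨σ₂, m₂, r₂, l₂, e₂, k₂⟩ := h₂ a _
    (show Function.update σ₁ (b + 2) (σ₁ b) (b + 2) = _ by simp [k₁ b (by omega), hσ])
  have hlow : ∀ r < b + 1, σ₂ r = σ r := fun r hr => by
    rw [k₂ r (by omega), Function.update_of_ne (by omega), k₁ r (by omega),
      Function.update_of_ne (by omega)]
  obtain ⟨σ₃, m₃, r₃, l₃, e₃, k₃⟩ := hloop a (l a) [] σ₂ rfl (by rw [hlow b (by omega), hσ])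
    (by rw [k₂ _ (by omega), Function.update_of_ne (by omega), e₁]) e₂
  have s₄ : Silent _ _ _ 1 := Run.copy σ₃ b (b + 2)
  refine ⟨_, _, (s₁.seq r₁).seq ((s₂.seq r₂).seq (r₃.seq s₄)), ?_, by simp [e₃], fun r hr => ?_⟩
  · have : (l a).length * T.eval (sz a) ≤ ql.eval (sz a) * T.eval (sz a) :=
      Nat.mul_le_mul_right _ ((length_le_sz _).trans (hql a))
    simp only [Polynomial.eval_add, Polynomial.eval_mul, Polynomial.eval_ofNat]
    omega
  · rw [Function.update_of_ne (by omega), k₃ r hr, hlow r (by omega)]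

end PolyTime

/-! ### Lists, Booleans and unary arithmetic in polynomial time -/

namespace PolyTime
variable {α β γ δ : Type} [Enc α] [Enc β] [Enc γ] [Enc δ]

/-- If each step adds at most a polynomial in the size of the input, independently of the
accumulator, then the accumulator stays polynomial over the whole list. -/
theorem foldl_of_step_size_le {l : α → List γ} {i : α → δ} {f : α → δ → γ → δ} (hl : PolyTime l)
    (hi : PolyTime i) (hf : PolyTime (fun q : α × δ × γ => f q.1 q.2.1 q.2.2))
    (hb : ∃ q : Polynomial ℕ, ∀ a d, ∀ c ∈ l a, sz (f a d c) ≤ sz d + q.eval (sz a)) :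
    PolyTime (fun a => (l a).foldl (f a) (i a)) := by
  obtain ⟨q, hq⟩ := hb
  obtain ⟨ql, hql⟩ := hl.size_bound
  obtain ⟨qi, hqi⟩ := hi.size_bound
  refine foldl hl hi hf ⟨qi + ql * q, fun a l' hl' => ?_⟩
  have h : ∀ (l' : List γ) (d : δ), (∀ c ∈ l', c ∈ l a) →
      sz (l'.foldl (f a) d) ≤ sz d + l'.length * q.eval (sz a) := by
    intro l'
    induction l' with
    | nil => simp
    | cons c l' ih =>
      intro d hc
      have h₁ := ih (f a d c) fun c' h' => hc _ (by simp [h'])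
      have h₂ := hq a d c (hc _ (by simp))
      simp only [foldl_cons, length_cons, add_mul, one_mul]
      omega
  refine (h l' _ fun c hc => hl'.subset hc).trans ?_
  simp only [Polynomial.eval_add, Polynomial.eval_mul]
  refine add_le_add (hqi a) (Nat.mul_le_mul_right _ ?_)
  exact hl'.length_le.trans ((length_le_sz _).trans (hql a))

@[fun_prop]
theorem reverse {l : α → List β} (hl : PolyTime l) : PolyTime (fun a => (l a).reverse) := by
  refine (foldl_of_step_size_le (f := fun _ (d : List β) c => c :: d) hl (const [])
    (by fun_prop) ?_).of_eq fun a => ?_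
  · obtain ⟨q, hq⟩ := hl.size_bound
    refine ⟨q + 1, fun a d c hc => ?_⟩
    have := sz_le_of_mem hc
    have := hq a
    simp only [sz_cons, Polynomial.eval_add, Polynomial.eval_one]
    omega
  · simp

@[fun_prop]
theorem map {l : α → List γ} {f : α → γ → β} (hl : PolyTime l)
    (hf : PolyTime (fun q : α × γ => f q.1 q.2)) : PolyTime (fun a => (l a).map (f a)) := by
  have h : PolyTime (fun a => ((l a).foldl (fun (d : List β) c => f a c :: d) []).reverse) := by
    refine (foldl_of_step_size_le (f := fun a (d : List β) c => f a c :: d) hl (const [])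
      ?_ ?_).reverse
    · exact (hf.comp (g := fun q : α × γ => f q.1 q.2)
        (f := fun q : α × List β × γ => (q.1, q.2.2)) (by fun_prop)).cons (by fun_prop)
    · obtain ⟨q, hq⟩ := hl.size_bound
      obtain ⟨q', hq'⟩ := hf.size_bound
      refine ⟨q'.comp (.X + q + 1) + 1, fun a d c hc => ?_⟩
      have h₁ := sz_le_of_mem hc
      have h₂ := hq a
      have h₃ := (hq' (a, c)).trans (eval_mono _
        (show sz (a, c) ≤ sz a + q.eval (sz a) + 1 by simp; omega))
      simp only [sz_cons, Polynomial.eval_add, Polynomial.eval_one, Polynomial.eval_comp,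
        Polynomial.eval_X] at h₃ ⊢
      omega
  exact h.of_eq fun a => by simp

@[fun_prop]
theorem filter {l : α → List γ} {f : α → γ → Bool} (hl : PolyTime l)
    (hf : PolyTime (fun q : α × γ => f q.1 q.2)) : PolyTime (fun a => (l a).filter (f a)) := by
  have h : PolyTime (fun a => ((l a).foldl
      (fun (d : List γ) c => bif f a c then c :: d else d) []).reverse) := by
    refine (foldl_of_step_size_le (f := fun a (d : List γ) c => bif f a c then c :: d else d) hl
      (const []) ?_ ?_).reverse
    · exact .cond (hf.comp (g := fun q : α × γ => f q.1 q.2)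
        (f := fun q : α × List γ × γ => (q.1, q.2.2)) (by fun_prop)) (by fun_prop) (by fun_prop)
    · obtain ⟨q, hq⟩ := hl.size_bound
      refine ⟨q + 1, fun a d c hc => ?_⟩
      have h₁ := sz_le_of_mem hc
      have h₂ := hq a
      simp only [Polynomial.eval_add, Polynomial.eval_one]
      rcases h : f a c with _ | _ <;> simp only [cond_true, cond_false, sz_cons] <;> omega
  refine h.of_eq fun a => ?_
  have : ∀ (l d : List γ), (l.foldl (fun (d : List γ) c => bif f a c then c :: d else d) d).reverse
      = d.reverse ++ l.filter (f a) := by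
    intro l
    induction l with
    | nil => simp
    | cons c l ih => intro d; cases h : f a c <;> simp [ih, h]
  simp [this]

@[fun_prop]
theorem not {s : α → Bool} (hs : PolyTime s) : PolyTime (fun a => !(s a)) :=
  (cond hs (const false) (const true)).of_eq fun a => by cases s a <;> rfl

@[fun_prop]
theorem and {s t : α → Bool} (hs : PolyTime s) (ht : PolyTime t) :
    PolyTime (fun a => s a && t a) :=
  (cond hs ht (const false)).of_eq fun a => by cases s a <;> rfl

@[fun_prop]
theorem or {s t : α → Bool} (hs : PolyTime s) (ht : PolyTime t) :
    PolyTime (fun a => s a || t a) :=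
  (cond hs (const true) ht).of_eq fun a => by cases s a <;> rfl

@[fun_prop]
theorem headD {l : α → List β} {x : α → β} (hl : PolyTime l) (hx : PolyTime x) :
    PolyTime (fun a => (l a).headD (x a)) :=
  (optionElim (f := fun _ b => b) hl.head? (by fun_prop) hx).of_eq fun a => by
    cases h : l a <;> simp

@[fun_prop]
theorem isEmpty {l : α → List β} (hl : PolyTime l) : PolyTime (fun a => (l a).isEmpty) :=
  (optionElim (f := fun _ _ => false) hl.head? (by fun_prop) (const true)).of_eq fun a => by
    cases h : l a <;> simp

@[fun_prop]
theorem all {l : α → List γ} {f : α → γ → Bool} (hl : PolyTime l)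
    (hf : PolyTime (fun q : α × γ => f q.1 q.2)) : PolyTime (fun a => (l a).all (f a)) := by
  have h : PolyTime (fun a => ((l a).filter fun c => !(f a c)).isEmpty) := by fun_prop
  refine h.of_eq fun a => ?_
  rw [Bool.eq_iff_iff]
  simp

@[fun_prop]
theorem replicateUnit {f : α → ℕ} (hf : PolyTime f) : PolyTime (fun a => replicate (f a) ()) :=
  (of_enc_eq (f := fun n : ℕ => replicate n ()) fun n => (enc_nat n).symm).comp hf

-- In unary, the successor of `n` is the same tree as the pair `((), n)`.
@[fun_prop]
theorem add_one {f : α → ℕ} (hf : PolyTime f) : PolyTime (fun a => f a + 1) :=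
  (of_enc_eq (f := fun p : Unit × ℕ => p.2 + 1) fun p => by
    rw [enc_nat]; change _ = Data.cons _ (enc p.2); rw [enc_nat]; rfl).comp (unit.prodMk hf)

@[fun_prop]
theorem length {l : α → List β} (hl : PolyTime l) : PolyTime (fun a => (l a).length) := by
  refine (foldl_of_step_size_le (f := fun _ d _ => d + 1) hl (const 0)
    (by fun_prop) ⟨2, fun a d c hc => ?_⟩).of_eq fun a => ?_
  · simp; omega
  · rw [foldl_const, Nat.succ_iterate, zero_add]

/-- The unary counter is itself a list to fold over. The size bound is a hypothesis because
iterating a polynomial-time step can make the size explode. -/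
theorem iterate {n : α → ℕ} {i : α → δ} {f : α → δ → δ} (hn : PolyTime n)
    (hi : PolyTime i) (hf : PolyTime (fun q : α × δ => f q.1 q.2))
    (hb : ∃ q : Polynomial ℕ, ∀ a, ∀ k ≤ n a, sz ((f a)^[k] (i a)) ≤ q.eval (sz a)) :
    PolyTime (fun a => (f a)^[n a] (i a)) := by
  obtain ⟨q, hq⟩ := hb
  refine (foldl (f := fun a d _ => f a d) hn.replicateUnit hi ?_
    ⟨q, fun a l' hl' => ?_⟩).of_eq fun a => ?_
  · exact hf.comp (f := fun q : α × δ × Unit => (q.1, q.2.1)) (by fun_prop)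
  · rw [foldl_const]
    exact hq a _ (by simpa using hl'.length_le)
  · rw [foldl_const, length_replicate]

@[fun_prop]
theorem drop {n : α → ℕ} {l : α → List β} (hn : PolyTime n) (hl : PolyTime l) :
    PolyTime (fun a => (l a).drop (n a)) := by
  have h : ∀ k (l : List β), List.tail^[k] l = l.drop k := by
    intro k
    induction k with
    | zero => simp
    | succ k ih => intro l; simp [ih]
  refine (iterate (f := fun _ l => l.tail) hn hl (by fun_prop) ?_).of_eq fun a => h _ _
  obtain ⟨q, hq⟩ := hl.size_bound
  refine ⟨q, fun a k _ => le_trans ?_ (hq a)⟩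
  rw [h]
  have := sz_append ((l a).take k) ((l a).drop k)
  have := sz_pos ((l a).take k)
  rw [take_append_drop] at *
  omega

@[fun_prop]
theorem getD {l : α → List β} {n : α → ℕ} {x : α → β} (hl : PolyTime l) (hn : PolyTime n)
    (hx : PolyTime x) : PolyTime (fun a => (l a).getD (n a) (x a)) := by
  have h : PolyTime (fun a => ((l a).drop (n a)).headD (x a)) := by fun_prop
  refine h.of_eq fun a => ?_
  simp [headD_eq_head?_getD, head?_drop]

@[fun_prop]
theorem add {f g : α → ℕ} (hf : PolyTime f) (hg : PolyTime g) : PolyTime (fun a => f a + g a) := by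
  refine (iterate (f := fun _ n => n + 1) hg hf (by fun_prop) ?_).of_eq fun a =>
    by rw [Nat.succ_iterate]
  obtain ⟨q, hq⟩ := hf.size_bound
  obtain ⟨q', hq'⟩ := hg.size_bound
  refine ⟨q + q', fun a k hk => ?_⟩
  have := hq a
  have := hq' a
  rw [Nat.succ_iterate]
  simp only [sz_nat, Polynomial.eval_add] at *
  omega

@[fun_prop]
theorem mul {f g : α → ℕ} (hf : PolyTime f) (hg : PolyTime g) : PolyTime (fun a => f a * g a) := by
  have h : ∀ a k, (fun n => n + f a)^[k] 0 = f a * k := by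
    intro a k
    simp [mul_comm]
  refine (iterate (i := fun _ => 0) (f := fun a n => n + f a) hg (const 0) ?_ ?_).of_eq fun a =>
    h _ _
  · exact add (by fun_prop) (hf.comp (by fun_prop))
  obtain ⟨q, hq⟩ := hf.size_bound
  obtain ⟨q', hq'⟩ := hg.size_bound
  refine ⟨q * q', fun a k hk => ?_⟩
  rw [h]
  have h₁ := hq a
  have h₂ := hq' a
  simp only [sz_nat, Polynomial.eval_mul] at *
  calc _ ≤ (2 * f a + 1) * (2 * g a + 1) := by nlinarith [Nat.mul_le_mul_left (f a) hk]
    _ ≤ _ := Nat.mul_le_mul h₁ h₂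

@[fun_prop]
theorem sub {f g : α → ℕ} (hf : PolyTime f) (hg : PolyTime g) : PolyTime (fun a => f a - g a) := by
  have h : PolyTime (fun a => ((replicate (f a) ()).drop (g a)).length) := by fun_prop
  exact h.of_eq fun a => by simp

@[fun_prop]
theorem ble {f g : α → ℕ} (hf : PolyTime f) (hg : PolyTime g) :
    PolyTime (fun a => (f a).ble (g a)) := by
  have h : PolyTime (fun a => ((replicate (f a) ()).drop (g a)).isEmpty) := by fun_prop
  refine h.of_eq fun a => ?_
  rw [Bool.eq_iff_iff]
  simp [Nat.sub_eq_zero_iff_le]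

@[fun_prop]
theorem beq {f g : α → ℕ} (hf : PolyTime f) (hg : PolyTime g) :
    PolyTime (fun a => (f a).beq (g a)) := by
  have h : PolyTime (fun a => (f a).ble (g a) && (g a).ble (f a)) := by fun_prop
  refine h.of_eq fun a => ?_
  rw [Bool.eq_iff_iff]
  simp
  omega

@[fun_prop]
theorem min {f g : α → ℕ} (hf : PolyTime f) (hg : PolyTime g) :
    PolyTime (fun a => min (f a) (g a)) := by
  have h : PolyTime (fun a => bif (f a).ble (g a) then f a else g a) := by fun_prop
  refine h.of_eq fun a => ?_
  simp [cond_eq_ite, min_def]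

@[fun_prop]
theorem range {n : α → ℕ} (hn : PolyTime n) : PolyTime (fun a => range (n a)) := by
  have h : ∀ k, (fun l : List ℕ => l.length :: l)^[k] [] = (List.range k).reverse := by
    intro k
    induction k with
    | zero => rfl
    | succ k ih => simp [Function.iterate_succ_apply', ih, range_succ]
  refine (iterate (i := fun _ => []) (f := fun _ l => l.length :: l) hn (const []) (by fun_prop)
    ?_).reverse.of_eq fun a => by rw [h, reverse_reverse]
  obtain ⟨q, hq⟩ := hn.size_bound
  refine ⟨q * (q + 1) + 1, fun a k hk => ?_⟩
  have h₁ := hq a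
  rw [sz_nat] at h₁
  rw [h]
  refine (sz_le_of_forall (n := 2 * k + 1) fun m hm => ?_).trans ?_
  · simp at hm; simp; omega
  · simp only [length_reverse, length_range, Polynomial.eval_add, Polynomial.eval_mul,
      Polynomial.eval_one]
    exact Nat.add_le_add_right (Nat.mul_le_mul (by omega) (by omega)) _

/-- A right fold is a left fold over the reversed list; prefixes of the reversal correspond to
suffixes, hence the form of the size bound. -/
theorem foldr {l : α → List γ} {i : α → δ} {f : α → γ → δ → δ} (hl : PolyTime l)
    (hi : PolyTime i) (hf : PolyTime (fun q : α × γ × δ => f q.1 q.2.1 q.2.2))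
    (hb : ∃ q : Polynomial ℕ, ∀ a l', l' <:+ l a →
      sz (l'.foldr (f a) (i a)) ≤ q.eval (sz a)) :
    PolyTime (fun a => (l a).foldr (f a) (i a)) := by
  obtain ⟨q, hq⟩ := hb
  refine (foldl (f := fun a d c => f a c d) hl.reverse hi ?_ ⟨q, fun a l' hl' => ?_⟩).of_eq
    fun a => by rw [foldl_reverse]
  · exact hf.comp (f := fun q : α × δ × γ => (q.1, q.2.2, q.2.1)) (by fun_prop)
  · have h := hq a l'.reverse (by rw [← reverse_prefix]; simpa using hl')
    rwa [foldr_reverse] at h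

end PolyTime

/-! ### Delays -/

/-- After `k` time units without output, the trace `t` continues with delays of at most `b`. -/
def DelayFrom (b : ℕ) : ℕ → Trace → Prop
  | k, [] => k ≤ b
  | k, none :: t => DelayFrom b (k + 1) t
  | k, some _ :: t => k ≤ b ∧ DelayFrom b 0 t

theorem DelayFrom.anti {b k k' : ℕ} {t : Trace} (h : DelayFrom b k t) (hk : k' ≤ k) :
    DelayFrom b k' t := by
  induction t generalizing k k' with
  | nil => exact hk.trans h
  | cons e t ih =>
    cases e with
    | none => exact ih (k := k + 1) h (by omega)
    | some d => exact ⟨hk.trans h.1, h.2⟩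

theorem DelayFrom.mono {b b' k : ℕ} {t : Trace} (h : DelayFrom b k t) (hb : b ≤ b') :
    DelayFrom b' k t := by
  induction t generalizing k with
  | nil => exact le_trans (α := ℕ) h hb
  | cons e t ih =>
    cases e with
    | none => exact ih (k := k + 1) h
    | some d => exact ⟨h.1.trans hb, ih h.2⟩

theorem DelayFrom.shift {b k : ℕ} {t : Trace} (h : DelayFrom b k t) (j : ℕ) :
    DelayFrom (b + j) (k + j) t := by
  induction t generalizing k with
  | nil => exact Nat.add_le_add_right (show k ≤ b from h) j
  | cons e t ih =>
    cases e with
    | none =>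
      have := ih (k := k + 1) h
      rwa [show k + 1 + j = k + j + 1 by omega] at this
    | some d => exact ⟨Nat.add_le_add_right h.1 j, h.2.mono (Nat.le_add_right _ _)⟩

/-- The counter form of the delay condition is suited to induction along a trace; the `k` time units
already elapsed become `k` leading silent entries. -/
theorem delayFrom_iff {b k : ℕ} {t : Trace} :
    DelayFrom b k t ↔ DelayAtMost (replicate k none ++ t) b := by
  induction t generalizing k with
  | nil =>
    rw [append_nil]
    refine ⟨fun h s hs _ => (hs.length_le.trans_eq length_replicate).trans h, fun h => ?_⟩
    exact length_replicate.symm.trans_le (h _ infix_rfl (by simp))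
  | cons e t ih =>
    cases e with
    | none =>
      rw [show replicate k none ++ none :: t = replicate (k + 1) none ++ t by
        rw [replicate_succ', append_assoc]; rfl]
      exact ih
    | some d =>
      change k ≤ b ∧ DelayFrom b 0 t ↔ _
      rw [ih, replicate_zero, nil_append]
      constructor
      · rintro ⟨h₁, h₂⟩ s ⟨u, v, huv⟩ hs
        rw [append_assoc, append_eq_append_iff] at huv
        -- A silent infix cannot contain `some d`, so it lies within the leading block or within
        -- `t`; the remaining positions are contradictory.
        rcases huv with ⟨w, h₃, h₄⟩ | ⟨w, h₃, h₄⟩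
        · rw [append_eq_append_iff] at h₄
          rcases h₄ with ⟨z, h₅, h₆⟩ | ⟨z, h₅, h₆⟩
          · have := congrArg length h₃
            have := congrArg length h₅
            simp at *
            omega
          · cases z with
            | nil =>
              have := congrArg length h₃
              have := congrArg length h₅
              simp at *
              omega
            | cons e z =>
              rw [cons_append, cons.injEq] at h₆
              have := hs e (by simp [h₅])
              simp [← h₆.1] at this
        · cases w with
          | nil =>
            rw [nil_append] at h₄
            cases s with
            | nil => simp
            | cons e s =>
              rw [cons_append, cons.injEq] at h₄
              have := hs e (by simp)
              simp [← h₄.1] at this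
          | cons e w =>
            rw [cons_append, cons.injEq] at h₄
            exact h₂ s ⟨w, v, by rw [h₄.2, append_assoc]⟩ hs
      · intro h
        refine ⟨?_, fun s hs => h s (hs.trans ?_)⟩
        · simpa using h (replicate k none) (prefix_append _ _).isInfix (by simp)
        · exact ((suffix_cons _ _).trans (suffix_append _ _)).isInfix

theorem delayAtMost_iff {b : ℕ} {t : Trace} : DelayAtMost t b ↔ DelayFrom b 0 t := by
  simp [delayFrom_iff]

theorem delayFrom_replicate_append {b k m : ℕ} {t : Trace} :
    DelayFrom b k (replicate m none ++ t) ↔ DelayFrom b (k + m) t := by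
  induction m generalizing k with
  | zero => rfl
  | succ m ih =>
    rw [replicate_succ, cons_append]
    exact ih.trans (by rw [show k + 1 + m = k + (m + 1) by omega])

@[simp] theorem outputs_nil : outputs [] = [] := rfl
@[simp] theorem outputs_append (t t' : Trace) : outputs (t ++ t') = outputs t ++ outputs t' := by
  simp [outputs]
@[simp] theorem outputs_replicate (m : ℕ) : outputs (replicate m none) = [] := by
  simp [outputs]
@[simp] theorem outputs_none (t : Trace) : outputs (none :: t) = outputs t := rfl
@[simp] theorem outputs_some (d : Data) (t : Trace) : outputs (some d :: t) = d :: outputs t := rfl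

/-- A trace with delays at most `b` and at least one output, preceded by `j` time units, and
followed by a trace that tolerates to be preceded by `b` time units. -/
theorem DelayFrom.append {b b' k j : ℕ} {t t' : Trace} (h : DelayFrom b k t) (hb : b + j ≤ b')
    (ht : outputs t ≠ []) (h' : DelayFrom b' b t') : DelayFrom b' (k + j) (t ++ t') := by
  have aux : ∀ (t : Trace) k, DelayFrom b k t → DelayFrom b' k (t ++ t') := by
    intro t
    induction t with
    | nil => intro k hk; exact h'.anti hk
    | cons e t ih =>
      intro k hk
      cases e with
      | none => exact ih (k + 1) hk
      | some d => exact ⟨hk.1.trans (by omega), ih 0 hk.2⟩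
  induction t generalizing k with
  | nil => exact absurd rfl ht
  | cons e t ih =>
    cases e with
    | none =>
      have := ih (k := k + 1) h ht
      rwa [show k + 1 + j = k + j + 1 by omega] at this
    | some d => exact ⟨by have := h.1; omega, aux t 0 h.2⟩

/-- `t'` is like `t`, with `f d` in place of each output `d`, each of which needs additional time
at most `B`. -/
inductive Sim (f : Data → Data) (B : ℕ) : Trace → Trace → Prop
  | nil : Sim f B [] []
  | none {t t' : Trace} : Sim f B t t' → Sim f B (none :: t) (none :: t')
  -- Time units may be dropped, in particular those that the original output instruction spends on
  -- writing.
  | skip {t t' : Trace} : Sim f B t t' → Sim f B (none :: t) t'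
  | some {t t' : Trace} {d : Data} {m : ℕ} : m ≤ B → Sim f B t t' →
      Sim f B (some d :: t) (replicate m none ++ some (f d) :: t')

namespace Sim
variable {f : Data → Data} {B : ℕ}

theorem append {t₁ t₁' t₂ t₂' : Trace} (h₁ : Sim f B t₁ t₁') (h₂ : Sim f B t₂ t₂') :
    Sim f B (t₁ ++ t₂) (t₁' ++ t₂') := by
  induction h₁ with
  | nil => exact h₂
  | none _ ih => exact ih.none
  | skip _ ih => exact ih.skip
  | some hm _ ih => rw [append_assoc]; exact ih.some hm

theorem outputs_eq {t t' : Trace} (h : Sim f B t t') : outputs t' = (outputs t).map f := by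
  induction h with
  | nil => rfl
  | none _ ih => exact ih
  | skip _ ih => exact ih
  | some hm _ ih => simp [ih]

theorem delayFrom {t t' : Trace} (h : Sim f B t t') {b k k' : ℕ} (ht : DelayFrom b k t)
    (hk : k' ≤ k) : DelayFrom (b + B) k' t' := by
  induction h generalizing k k' with
  | nil => exact hk.trans (le_trans (α := ℕ) ht (Nat.le_add_right _ _))
  | none _ ih => exact ih (k := k + 1) (k' := k' + 1) ht (by omega)
  | skip _ ih => exact ih (k := k + 1) ht (by omega)
  | some hm _ ih =>
    rw [delayFrom_replicate_append]
    exact ⟨by have := ht.1; omega, ih ht.2 le_rfl⟩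

theorem replicate_skip (m : ℕ) {t t' : Trace} (h : Sim f B t t') :
    Sim f B (replicate m Option.none ++ t) t' := by
  induction m with
  | zero => exact h
  | succ m ih => rw [replicate_succ]; exact ih.skip

end Sim

/-! ### Programs with modified outputs -/

namespace Cmd

/-- A strict upper bound for the registers that occur in the program. -/
def bound : Cmd → ℕ
  | setNil x => x + 1
  | copy x y => max x y + 1
  | pair x y z => max x (max y z) + 1
  | left x y => max x y + 1
  | right x y => max x y + 1
  | output x => x + 1
  | seq c₁ c₂ => max c₁.bound c₂.bound
  | ite x c₁ c₂ => max (x + 1) (max c₁.bound c₂.bound)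
  | loop x c => max (x + 1) c.bound

/-- Replace each output instruction by a program. -/
def mapOutput (g : ℕ → Cmd) : Cmd → Cmd
  | output x => g x
  | seq c₁ c₂ => seq (c₁.mapOutput g) (c₂.mapOutput g)
  | ite x c₁ c₂ => ite x (c₁.mapOutput g) (c₂.mapOutput g)
  | loop x c => loop x (c.mapOutput g)
  | c => c

end Cmd

/-- The store `τ` has the contents of `σ` in the registers below `K`, and `e` in register `K`. -/
def Extends (K : ℕ) (e : Data) (σ τ : Store) : Prop := (∀ r < K, τ r = σ r) ∧ τ K = e

theorem Extends.update {K : ℕ} {e : Data} {σ τ : Store} (h : Extends K e σ τ) {x : ℕ} (hx : x < K)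
    {d d' : Data} (hd : d = d') :
    Extends K e (Function.update σ x d) (Function.update τ x d') := by
  subst hd
  refine ⟨fun r hr => ?_, ?_⟩
  · by_cases h' : r = x
    · simp [h']
    · simp [h', h.1 r hr]
  · rw [Function.update_of_ne hx.ne', h.2]

/-- If the output instructions of a program are replaced by programs that output something else
and use only additional registers, then the modified program simulates the original one. -/
theorem Run.mapOutput {K B : ℕ} {e : Data} {f : Data → Data} {g : ℕ → Cmd} {c : Cmd}
    {σ σ' : Store} {t : Trace} (h : Run c σ σ' t) (hK : c.bound ≤ K)
    (hg : ∀ d ∈ outputs t, ∀ x < K, ∀ τ : Store, τ x = d → τ K = e →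
      ∃ τ' m, Run (g x) τ τ' (replicate m none ++ [some (f d)]) ∧ m ≤ B ∧ ∀ r ≤ K, τ' r = τ r)
    (τ : Store) (hτ : Extends K e σ τ) :
    ∃ τ' t', Run (c.mapOutput g) τ τ' t' ∧ Extends K e σ' τ' ∧ Sim f B t t' := by
  induction h generalizing τ with
  | setNil σ x =>
    exact ⟨_, _, .setNil τ x, hτ.update hK rfl, .none .nil⟩
  | copy σ x y =>
    simp only [Cmd.bound, Nat.succ_le_iff, max_lt_iff] at hK
    exact ⟨_, _, .copy τ x y, hτ.update hK.1 (hτ.1 y hK.2).symm, .none .nil⟩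
  | pair σ x y z =>
    simp only [Cmd.bound, Nat.succ_le_iff, max_lt_iff] at hK
    exact ⟨_, _, .pair τ x y z,
      hτ.update hK.1 (by rw [hτ.1 y hK.2.1, hτ.1 z hK.2.2]), .none .nil⟩
  | left σ x y =>
    simp only [Cmd.bound, Nat.succ_le_iff, max_lt_iff] at hK
    exact ⟨_, _, .left τ x y, hτ.update hK.1 (by rw [hτ.1 y hK.2]), .none .nil⟩
  | right σ x y =>
    simp only [Cmd.bound, Nat.succ_le_iff, max_lt_iff] at hK
    exact ⟨_, _, .right τ x y, hτ.update hK.1 (by rw [hτ.1 y hK.2]), .none .nil⟩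
  | output σ x =>
    obtain ⟨τ', m, h₁, h₂, h₃⟩ := hg (σ x) (by simp) x hK τ (hτ.1 x hK) hτ.2
    exact ⟨τ', _, h₁, ⟨fun r hr => (h₃ r hr.le).trans (hτ.1 r hr), (h₃ K le_rfl).trans hτ.2⟩,
      Sim.replicate_skip _ (.some h₂ .nil)⟩
  | seq _ _ ih₁ ih₂ =>
    simp only [Cmd.bound, max_le_iff] at hK
    obtain ⟨τ₁, t₁, r₁, x₁, s₁⟩ := ih₁ hK.1 (fun d hd => hg d (by simp [hd])) τ hτ
    obtain ⟨τ₂, t₂, r₂, x₂, s₂⟩ := ih₂ hK.2 (fun d hd => hg d (by simp [hd])) τ₁ x₁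
    exact ⟨τ₂, _, .seq r₁ r₂, x₂, s₁.append s₂⟩
  | ite_true hx _ ih =>
    simp only [Cmd.bound, max_le_iff] at hK
    obtain ⟨τ₁, t₁, r₁, x₁, s₁⟩ := ih hK.2.1 hg τ hτ
    exact ⟨τ₁, _, .ite_true (by rwa [hτ.1 _ hK.1]) r₁, x₁, s₁.none⟩
  | ite_false hx _ ih =>
    simp only [Cmd.bound, max_le_iff] at hK
    obtain ⟨τ₁, t₁, r₁, x₁, s₁⟩ := ih hK.2.2 hg τ hτ
    exact ⟨τ₁, _, .ite_false (by rwa [hτ.1 _ hK.1]) r₁, x₁, s₁.none⟩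
  | loop_true hx _ _ ih₁ ih₂ =>
    have hK' := hK
    simp only [Cmd.bound, max_le_iff] at hK
    obtain ⟨τ₁, t₁, r₁, x₁, s₁⟩ := ih₁ hK.2 (fun d hd => hg d (by simp [hd])) τ hτ
    obtain ⟨τ₂, t₂, r₂, x₂, s₂⟩ := ih₂ hK' (fun d hd => hg d (by simp [hd])) τ₁ x₁
    exact ⟨τ₂, _, .loop_true (by rwa [hτ.1 _ hK.1]) r₁ r₂, x₂, (s₁.append s₂).none⟩
  | loop_false hx =>
    simp only [Cmd.bound, max_le_iff] at hK
    exact ⟨τ, _, .loop_false (by rwa [hτ.1 _ hK.1]), hτ, .none .nil⟩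

/-- Empty the registers below `K`. -/
theorem exists_clear (K : ℕ) : ∃ c : Cmd, ∃ m, ∀ σ : Store, ∃ σ', Silent c σ σ' m ∧
    (∀ r < K, σ' r = .nil) ∧ ∀ r, K ≤ r → σ' r = σ r := by
  induction K with
  | zero =>
    exact ⟨.copy 0 0, 1, fun σ => ⟨_, Run.copy σ 0 0, by simp, fun r _ => by simp⟩⟩
  | succ K ih =>
    obtain ⟨c, m, h⟩ := ih
    refine ⟨.seq c (.setNil K), m + 1, fun σ => ?_⟩
    obtain ⟨σ', r, h₁, h₂⟩ := h σ
    have s : Silent _ _ _ 1 := Run.setNil σ' K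
    refine ⟨_, r.seq s, fun r hr => ?_, fun r hr => ?_⟩
    · by_cases hr' : r = K
      · simp [hr']
      · rw [Function.update_of_ne hr', h₁ r (by omega)]
    · rw [Function.update_of_ne (by omega), h₂ r (by omega)]

/-! ### The reduction -/

/-- The list is the sequence of states that `next` runs through from its first element. -/
def Steps {σ : Type} (next : σ → Option σ) : List σ → Prop
  | [] => True
  | a :: l => next a = l.head? ∧ Steps next l

section Reduction
variable {ρ σ τ ω ω' : Type} [Enc ρ] [Enc σ] [Enc τ] [Enc ω] [Enc ω']

/-- The outputs and the time of the program that treats one state. -/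
theorem exists_body (henc : Function.Injective (enc : ω → Data)) {P : EnumProblem} {c : Cmd} {p : Polynomial ℕ}
    (hc : ∀ j : P.Instance, ∃ (σ : Store) (t : Trace), Run c (initStore (P.encode j)) σ t ∧
      (outputs t).Nodup ∧ (∀ d, d ∈ outputs t ↔ d ∈ P.Sol j) ∧
      DelayAtMost t (p.eval (P.encode j).size))
    {next : σ → Option σ} {build : σ → τ} {post : σ × ω → ω'}
    (hnext : PolyTime next) (hbuild : PolyTime build) (hpost : PolyTime post) :
    ∃ (K : ℕ) (body : Cmd) (D W : Polynomial ℕ), 0 < K ∧ ∀ (s : σ) (A : Set ω) (j : P.Instance),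
      P.encode j = enc (build s) → P.Sol j = enc '' A → A.Nonempty →
      (∀ w ∈ A, ∀ w' ∈ A, enc (post (s, w)) = enc (post (s, w')) → w = w') →
      ∀ N, sz s ≤ N → (∀ w ∈ A, sz w ≤ N) →
      ∀ τ : Store, τ K = .cons (enc s) .nil →
      ∃ τ' m t m', Run body τ τ' (replicate m none ++ (t ++ replicate m' none)) ∧
        τ' K = enc (next s) ∧ (outputs t).Nodup ∧
        (∀ d, d ∈ outputs t ↔ ∃ w ∈ A, enc (post (s, w)) = d) ∧ outputs t ≠ [] ∧
        DelayFrom (D.eval N) 0 t ∧ m ≤ W.eval N ∧ m' ≤ W.eval N := by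
  -- Register `K` lies above all registers of `c` and stores the state during the call; it is also
  -- different from the input register `0`.
  obtain ⟨K, hKdef⟩ : ∃ K, K = c.bound + 1 := ⟨_, rfl⟩
  obtain ⟨-, hnext⟩ := hnext
  obtain ⟨⟨qb, hqb⟩, hbuild⟩ := hbuild
  obtain ⟨⟨qp, hqp⟩, hpost⟩ := hpost
  obtain ⟨cn, pn, hn⟩ := hnext K
  obtain ⟨cb, pb, hb⟩ := hbuild (K + 1)
  obtain ⟨cp, pp, hp⟩ := hpost (K + 1)
  obtain ⟨cl, ml, hl⟩ := exists_clear K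
  let g : ℕ → Cmd := fun x => .seq (.seq (.pair (K + 1) K x) cp) (.output (K + 1))
  -- Additional time per output: one pairing, the computation of `post`, and the writing of its
  -- value. A pair of two objects of size at most `N` has size at most `2 * N + 1`.
  let B : Polynomial ℕ := 1 + pp.comp (2 * .X + 1) + qp.comp (2 * .X + 1)
  refine ⟨K, .seq (.seq (.left K K) (.seq (.copy (K + 1) K) (.seq cb (.seq cl (.copy 0 (K + 1))))))
    (.seq (c.mapOutput g) cn), p.comp qb + B, pb + pn + .C (ml + 3), by omega,
    fun s A j hj hA hne hinj N hsN hwN τ hτ => ?_⟩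
  classical
  -- The effect of `post` on trees. As `enc` is injective, the chosen preimage is the right one;
  -- values on other trees never matter.
  let f : Data → Data := fun d => if h : ∃ w ∈ A, enc w = d then enc (post (s, h.choose)) else d
  have hf : ∀ w ∈ A, f (enc w) = enc (post (s, w)) := by
    intro w hw
    have h : ∃ w' ∈ A, enc w' = enc w := ⟨w, hw, rfl⟩
    rw [show f (enc w) = _ from dif_pos h, henc h.choose_spec.2]
  obtain ⟨σc, t, hrun, hnd, hmem, hdel⟩ := hc j
  have s₁ : Silent _ _ _ 1 := Run.left τ K K
  set τ₁ := Function.update τ K (τ K).fst with hτ₁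
  have s₂ : Silent _ _ _ 1 := Run.copy τ₁ (K + 1) K
  set τ₂ := Function.update τ₁ (K + 1) (τ₁ K) with hτ₂
  obtain ⟨τ₃, m₃, s₃, l₃, e₃, k₃⟩ := hb s τ₂ (by simp [hτ₂, hτ₁, hτ, Data.fst])
  -- The called program expects empty registers apart from its input, so what an earlier call left
  -- behind has to be erased.
  obtain ⟨τ₄, s₄, e₄, k₄⟩ := hl τ₃
  have s₅ : Silent _ _ _ 1 := Run.copy τ₄ 0 (K + 1)
  set τ₅ := Function.update τ₄ 0 (τ₄ (K + 1)) with hτ₅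
  have hext : Extends K (enc s) (initStore (P.encode j)) τ₅ := by
    constructor
    · intro r hr
      by_cases h0 : r = 0
      · subst h0
        simp [hτ₅, initStore, hj, k₄ (K + 1) (by omega), e₃]
      · simp [hτ₅, initStore, h0, e₄ r hr]
    · rw [hτ₅, Function.update_of_ne (by omega), k₄ K le_rfl, k₃ K (by omega), hτ₂,
        Function.update_of_ne (by omega), hτ₁]
      simp [hτ, Data.fst]
  obtain ⟨τ₆, t', r₆, x₆, sim⟩ := hrun.mapOutput (K := K) (B := B.eval N) (e := enc s) (f := f)
    (g := g) (by omega) (by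
      intro d hd x hx υ hυ hυK
      rw [hmem, hA] at hd
      obtain ⟨w, hw, rfl⟩ := hd
      have u₁ : Silent _ _ _ 1 := Run.pair υ (K + 1) K x
      obtain ⟨υ₂, m₂, u₂, b₂, d₂, n₂⟩ := hp (s, w) (Function.update υ (K + 1) (.cons (υ K) (υ x)))
        (by simp [hυ, hυK]; rfl)
      have hsz : sz (s, w) ≤ 2 * N + 1 := by
        have := hwN w hw
        simp only [sz_pair]; omega
      have h₁ := b₂.trans (eval_mono pp hsz)
      have h₂ := (hqp (s, w)).trans (eval_mono qp hsz)
      refine ⟨υ₂, 1 + m₂ + sz (post (s, w)), ?_, ?_, fun r hr => ?_⟩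
      · have := Run.seq (u₁.seq u₂) (Run.output υ₂ (K + 1))
        rw [d₂] at this
        rw [hf w hw, replicate_add, append_assoc]
        exact this
      · simp only [B, Polynomial.eval_add, Polynomial.eval_comp, Polynomial.eval_mul,
          Polynomial.eval_X, Polynomial.eval_one, Polynomial.eval_ofNat]
        omega
      · rw [n₂ r (by omega), Function.update_of_ne (by omega)]) τ₅ hext
  obtain ⟨τ₇, m₇, s₇, l₇, e₇, k₇⟩ := hn s τ₆ x₆.2
  have hl₃ := l₃.trans (eval_mono pb hsN)
  have hl₇ := l₇.trans (eval_mono pn hsN)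
  refine ⟨τ₇, _, t', m₇, .seq (s₁.seq (s₂.seq (s₃.seq (s₄.seq s₅)))) (.seq r₆ s₇), e₇, ?_, ?_, ?_,
    ?_, ?_, ?_⟩
  · rw [sim.outputs_eq]
    refine hnd.map_on fun d hd d' hd' h => ?_
    rw [hmem, hA] at hd hd'
    obtain ⟨w, hw, rfl⟩ := hd
    obtain ⟨w', hw', rfl⟩ := hd'
    rw [hf w hw, hf w' hw'] at h
    rw [hinj w hw w' hw' h]
  · intro d
    simp only [sim.outputs_eq, mem_map, hmem, hA]
    constructor
    · rintro ⟨-, ⟨w, hw, rfl⟩, rfl⟩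
      exact ⟨w, hw, (hf w hw).symm⟩
    · rintro ⟨w, hw, rfl⟩
      exact ⟨enc w, ⟨w, hw, rfl⟩, hf w hw⟩
  · rw [sim.outputs_eq]
    obtain ⟨w, hw⟩ := hne
    have : enc w ∈ outputs t := by rw [hmem, hA]; exact ⟨w, hw, rfl⟩
    intro h
    simp_all
  · rw [Polynomial.eval_add, Polynomial.eval_comp]
    refine sim.delayFrom ((delayAtMost_iff.1 hdel).mono ?_) le_rfl
    rw [hj]
    exact eval_mono _ ((hqb s).trans (eval_mono _ hsN))
  · simp only [Polynomial.eval_add, Polynomial.eval_C]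
    omega
  · simp only [Polynomial.eval_add, Polynomial.eval_C]
    omega

/-- Enumeration of the solutions of an instance by running through a sequence of states, to each
of which belongs an instance of a problem with a polynomial-delay algorithm whose solutions
are translated into solutions of the given instance. -/
theorem EnumProblem.AdmitsPolyDelay.reduce (henc : Function.Injective (enc : ω → Data))
    {P Q : EnumProblem} (hP : P.AdmitsPolyDelay)
    {init : ρ → Option σ} {next : σ → Option σ} {build : σ → τ} {post : σ × ω → ω'}
    (hinit : PolyTime init) (hnext : PolyTime next) (hbuild : PolyTime build)
    (hpost : PolyTime post) (q : Polynomial ℕ)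
    (H : ∀ i : Q.Instance, ∃ (a : ρ) (L : List σ) (A : σ → Set ω),
      Q.encode i = enc a ∧ init a = L.head? ∧ Steps next L ∧
      (∀ s ∈ L, sz s ≤ q.eval (sz a) ∧ (∀ w ∈ A s, sz w ≤ q.eval (sz a)) ∧ (A s).Nonempty ∧
        (∃ j : P.Instance, P.encode j = enc (build s) ∧ P.Sol j = enc '' A s) ∧
        ∀ w ∈ A s, ∀ w' ∈ A s, enc (post (s, w)) = enc (post (s, w')) → w = w') ∧
      L.Pairwise (fun s s' => ∀ w ∈ A s, ∀ w' ∈ A s', enc (post (s, w)) ≠ enc (post (s', w'))) ∧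
      ∀ d, d ∈ Q.Sol i ↔ ∃ s ∈ L, ∃ w ∈ A s, enc (post (s, w)) = d) :
    Q.AdmitsPolyDelay := by
  obtain ⟨c, p, hc⟩ := hP
  obtain ⟨K, body, D, W, hK, hbody⟩ := exists_body henc hc hnext hbuild hpost
  obtain ⟨ci, pi, hi⟩ := hinit.2 K
  -- The longest silent period between two states consists of the end of one call (`D`), the
  -- computation of the next state (`W`), the loop test, the preparation of the next call (`W`) and
  -- its beginning (`D`). The other terms pay for the initial state.
  refine ⟨.seq (.copy K 0) (.seq ci (.loop K body)), (2 * D + 2 * W + 1).comp q + pi + 2,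
    fun i => ?_⟩
  obtain ⟨a, L, A, ha, hinit, hsteps, hL, hpair, hsol⟩ := H i
  obtain ⟨N, hN⟩ : ∃ N, N = q.eval (sz a) := ⟨_, rfl⟩
  rw [← hN] at hL
  -- The loop must tolerate being entered when `D + W` silent units have already passed: the end of
  -- the previous call and the computation of the state.
  have hloop : ∀ L : List σ, Steps next L →
      (∀ s ∈ L, sz s ≤ N ∧ (∀ w ∈ A s, sz w ≤ N) ∧ (A s).Nonempty ∧
        (∃ j : P.Instance, P.encode j = enc (build s) ∧ P.Sol j = enc '' A s) ∧
        ∀ w ∈ A s, ∀ w' ∈ A s, enc (post (s, w)) = enc (post (s, w')) → w = w') →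
      L.Pairwise (fun s s' => ∀ w ∈ A s, ∀ w' ∈ A s', enc (post (s, w)) ≠ enc (post (s', w'))) →
      ∀ σ : Store, σ K = enc L.head? → ∃ σ' t, Run (.loop K body) σ σ' t ∧ (outputs t).Nodup ∧
        (∀ d, d ∈ outputs t ↔ ∃ s ∈ L, ∃ w ∈ A s, enc (post (s, w)) = d) ∧
        DelayFrom (2 * D.eval N + 2 * W.eval N + 1) (D.eval N + W.eval N) t := by
    intro L
    induction L with
    | nil =>
      intro _ _ _ σ hσ
      refine ⟨σ, _, .loop_false hσ, by simp, by simp, ?_⟩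
      change D.eval N + W.eval N + 1 ≤ _
      omega
    | cons s L ih =>
      intro hs hL hp σ hσ
      obtain ⟨h₁, h₂, h₃, ⟨j, hj, hjA⟩, h₄⟩ := hL s (by simp)
      obtain ⟨σ₁, m, t, m', r₁, e₁, nd, ht, hne, hdel, hm, hm'⟩ :=
        hbody s (A s) j hj hjA h₃ h₄ N h₁ h₂ σ hσ
      rw [hs.1] at e₁
      rw [pairwise_cons] at hp
      obtain ⟨σ₂, t', r₂, nd', ht', hdel'⟩ :=
        ih hs.2 (fun s' hs' => hL s' (by simp [hs'])) hp.2 σ₁ e₁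
      refine ⟨σ₂, _, .loop_true (by rw [hσ]; simp) r₁ r₂, ?_, fun d => ?_, ?_⟩
      · simp only [outputs_none, outputs_append, outputs_replicate, nil_append, append_nil]
        refine nd.append nd' fun d hd hd' => ?_
        obtain ⟨w, hw, rfl⟩ := (ht d).1 hd
        obtain ⟨s', hs', w', hw', h⟩ := (ht' _).1 hd'
        exact hp.1 s' hs' w hw w' hw' h.symm
      · simp [ht, ht']
      · change DelayFrom _ (_ + 1) _
        rw [append_assoc, delayFrom_replicate_append, append_assoc]
        -- Here nonemptiness of the class is essential: the call has an output, which separates the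
        -- waiting time before it from the time after it.
        have := hdel.append (b' := 2 * D.eval N + 2 * W.eval N + 1)
          (j := D.eval N + W.eval N + 1 + m) (by omega) hne
          (t' := replicate m' none ++ t')
          (by rw [delayFrom_replicate_append]; exact hdel'.anti (by omega))
        rwa [zero_add] at this
  have s₁ : Silent _ _ _ 1 := Run.copy (initStore (Q.encode i)) K 0
  obtain ⟨σ₂, m₂, r₂, l₂, e₂, -⟩ := hi a
    (Function.update (initStore (Q.encode i)) K (initStore (Q.encode i) 0))
    (by simp [initStore, ha])
  rw [hinit] at e₂
  obtain ⟨σ₃, t, r₃, nd, ht, hdel⟩ := hloop L hsteps hL hpair σ₂ e₂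
  refine ⟨σ₃, _, .seq s₁ (.seq r₂ r₃), ?_, fun d => ?_, ?_⟩
  · simpa using nd
  · simp [ht, hsol]
  · rw [delayAtMost_iff, delayFrom_replicate_append, delayFrom_replicate_append, ha]
    refine ((hdel.anti (Nat.zero_le _)).shift (1 + m₂)).mono ?_ |>.anti (by omega)
    simp only [Polynomial.eval_add, Polynomial.eval_mul, Polynomial.eval_comp,
      Polynomial.eval_one, Polynomial.eval_ofNat]
    change _ ≤ 2 * D.eval (q.eval (sz a)) + 2 * W.eval (q.eval (sz a)) + 1 + pi.eval (sz a) + 2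
    rw [← hN]
    omega

end Reduction

/-! ### Running through the subsets of given size -/

/-- The greedy choice, from the right, of `k` positions at which `m` is true, and what remains
of `k`. -/
def firstChoice (m : List Bool) (k : ℕ) : ℕ × List (Bool × Bool) :=
  m.foldr (fun a d => bif a && Nat.ble 1 d.1 then (d.1 - 1, (a, true) :: d.2)
    else (d.1, (a, false) :: d.2)) (k, [])

/-- The number of chosen positions. -/
def weight (l : List (Bool × Bool)) : ℕ := (l.filter fun p => p.2).length

/-- The list itself and the choice of positions that follows it. -/
def nextChoiceAux (l : List (Bool × Bool)) : List (Bool × Bool) × Option (List (Bool × Bool)) :=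
  l.foldr (fun p d => (p :: d.1, d.2.elim
    -- Lexicographic successor, unchosen before chosen. If the tail has no successor, this position
    -- becomes chosen, provided that it is admissible and still free and that the tail can give up
    -- one choice; the tail then restarts with one choice fewer.
    (bif p.1 && !p.2 && Nat.ble 1 (weight d.1) then
      some ((true, true) :: (firstChoice (d.1.map fun p => p.1) (weight d.1 - 1)).2) else none)
    fun l => some (p :: l))) ([], none)

/-- The choice of equally many positions that follows the given one. -/
def nextChoice (l : List (Bool × Bool)) : Option (List (Bool × Bool)) := (nextChoiceAux l).2

/-- All choices of `k` positions at which `m` is true. -/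
def choices : List Bool → ℕ → List (List (Bool × Bool))
  | [], 0 => [[]]
  | [], _ + 1 => []
  | false :: m, k => (choices m k).map ((false, false) :: ·)
  | true :: m, 0 => (choices m 0).map ((true, false) :: ·)
  | true :: m, k + 1 =>
    (choices m (k + 1)).map ((true, false) :: ·) ++ (choices m k).map ((true, true) :: ·)

/-! ### Correctness of the run through the choices -/

@[simp] theorem weight_nil : weight [] = 0 := rfl
@[simp] theorem weight_cons_true (a : Bool) (l : List (Bool × Bool)) :
    weight ((a, true) :: l) = weight l + 1 := by simp [weight]
@[simp] theorem weight_cons_false (a : Bool) (l : List (Bool × Bool)) :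
    weight ((a, false) :: l) = weight l := by simp [weight]

theorem firstChoice_cons (a : Bool) (m : List Bool) (k : ℕ) :
    firstChoice (a :: m) k = bif a && Nat.ble 1 (firstChoice m k).1 then
      ((firstChoice m k).1 - 1, (a, true) :: (firstChoice m k).2)
      else ((firstChoice m k).1, (a, false) :: (firstChoice m k).2) := rfl

theorem ble_eq_decide (m n : ℕ) : Nat.ble m n = decide (m ≤ n) := by
  rw [Bool.eq_iff_iff, Nat.ble_eq, decide_eq_true_iff]

theorem firstChoice_fst (m : List Bool) (k : ℕ) : (firstChoice m k).1 = k - m.count true := by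
  induction m with
  | nil => rfl
  | cons a m ih =>
    rw [firstChoice_cons]
    cases a with
    | false => simp [ih]
    | true =>
      simp only [ble_eq_decide, ih, Bool.true_and, Bool.cond_decide, count_cons_self]
      split <;> simp only <;> omega

theorem firstChoice_length (m : List Bool) (k : ℕ) : (firstChoice m k).2.length = m.length := by
  induction m with
  | nil => rfl
  | cons a m ih =>
    rw [firstChoice_cons]
    cases h : a && Nat.ble 1 (firstChoice m k).1 <;> simp [ih]

/-- The greedy choice already takes every admissible position, so a larger demand changes only the
remainder. -/
theorem firstChoice_succ {m : List Bool} {k : ℕ} (h : m.count true ≤ k) :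
    (firstChoice m (k + 1)).2 = (firstChoice m k).2 := by
  induction m generalizing k with
  | nil => rfl
  | cons a m ih =>
    have h₁ := firstChoice_fst m k
    have h₂ := firstChoice_fst m (k + 1)
    cases a with
    | false =>
      simp only [count_cons, beq_iff_eq, Bool.false_eq_true, if_false, add_zero] at h
      simp [firstChoice_cons, ih h]
    | true =>
      simp only [count_cons, beq_self_eq_true, if_true] at h
      have e₁ : Nat.ble 1 (firstChoice m k).1 = true := by simp; omega
      have e₂ : Nat.ble 1 (firstChoice m (k + 1)).1 = true := by simp; omega
      simp only [firstChoice_cons, e₁, e₂, Bool.and_self, cond_true]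
      rw [ih (by omega)]

theorem head?_choices (m : List Bool) (k : ℕ) :
    (choices m k).head? = if k ≤ m.count true then some (firstChoice m k).2 else none := by
  induction m generalizing k with
  | nil => cases k <;> rfl
  | cons a m ih =>
    cases a with
    | false => simp [choices, ih, firstChoice_cons, apply_ite]
    | true =>
      cases k with
      | zero => simp [choices, ih, firstChoice_cons, firstChoice_fst, ble_eq_decide]
      | succ k =>
        have h₁ := firstChoice_fst m (k + 1)
        simp only [choices, head?_append, head?_map, ih, firstChoice_cons, count_cons_self]
        by_cases h : k + 1 ≤ m.count true
        · have : Nat.ble 1 (firstChoice m (k + 1)).1 = false := by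
            rw [h₁, Bool.eq_false_iff, ne_eq, Nat.ble_eq]; omega
          simp [h, this, show k ≤ m.count true by omega]
        -- The tail has at most `k` admissible positions. The block that leaves the front position
        -- unchosen is thus empty, and the greedy choice takes that position.
        · have : Nat.ble 1 (firstChoice m (k + 1)).1 = true := by rw [Nat.ble_eq]; omega
          simp only [h, this]
          by_cases h' : k ≤ m.count true
          · simp [h', firstChoice_succ (show m.count true ≤ k by omega)]
          · simp [h']

theorem mem_choices {m : List Bool} {k : ℕ} {l : List (Bool × Bool)} :
    l ∈ choices m k ↔ l.map Prod.fst = m ∧ (∀ p ∈ l, p.2 = true → p.1 = true) ∧ weight l = k := by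
  induction m generalizing k l with
  | nil =>
    cases k with
    | zero => simp +contextual [choices]
    | succ k => simp +contextual [choices]
  | cons a m ih =>
    rcases l with _ | ⟨⟨x, y⟩, l⟩
    · cases a <;> cases k <;> simp [choices]
    · cases a <;> cases k <;> cases x <;> cases y <;> simp [choices, ih]

theorem nextChoiceAux_fst (l : List (Bool × Bool)) : (nextChoiceAux l).1 = l := by
  induction l with
  | nil => rfl
  | cons p l ih => exact congrArg (p :: ·) ih

theorem nextChoice_cons (p : Bool × Bool) (l : List (Bool × Bool)) :
    nextChoice (p :: l) = (nextChoice l).elim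
      (bif p.1 && !p.2 && Nat.ble 1 (weight l) then
        some ((true, true) :: (firstChoice (l.map fun p => p.1) (weight l - 1)).2) else none)
      fun l => some (p :: l) := by
  have h : nextChoice (p :: l) = (nextChoice l).elim
      (bif p.1 && !p.2 && Nat.ble 1 (weight (nextChoiceAux l).1) then
        some ((true, true) :: (firstChoice ((nextChoiceAux l).1.map fun p => p.1)
          (weight (nextChoiceAux l).1 - 1)).2) else none)
      fun l => some (p :: l) := rfl
  rwa [nextChoiceAux_fst] at h

/-- Glues two runs: inside the first one `f` carries steps to steps, and where the first run stops,
the second one begins. -/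
theorem steps_map_append {σ τ : Type} {nx : σ → Option σ} {nx' : τ → Option τ} {f : σ → τ}
    {l : List σ} {l' : List τ} (h : Steps nx l)
    (h₁ : ∀ a ∈ l, ∀ b, nx a = some b → nx' (f a) = some (f b))
    (h₂ : ∀ a ∈ l, nx a = none → nx' (f a) = l'.head?) (h' : Steps nx' l') :
    Steps nx' (l.map f ++ l') := by
  induction l with
  | nil => exact h'
  | cons a l ih =>
    refine ⟨?_, ih h.2 (fun b hb => h₁ b (by simp [hb])) fun b hb => h₂ b (by simp [hb])⟩
    have h3 := h.1
    change nx' (f a) = _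
    cases l with
    | nil => exact h₂ a (by simp) h3
    | cons b l => exact h₁ a (by simp) b h3

/-- Both blocks in the recursion of `choices` are copies of runs on the tail; the jump from the
first block to the second is the case in which the tail has no successor. -/
theorem steps_choices (m : List Bool) (k : ℕ) : Steps nextChoice (choices m k) := by
  induction m generalizing k with
  | nil => cases k <;> simp [choices, Steps, nextChoice, nextChoiceAux]
  | cons a m ih =>
    -- This covers the blocks that end a run: the front position cannot be turned into a chosen one,
    -- or the tail has no choice to give up.
    have key : ∀ (p : Bool × Bool) k l', ((p.1 && !p.2) = false ∨ k = 0) → l' = [] →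
        Steps nextChoice ((choices m k).map (p :: ·) ++ l') := by
      rintro p k l' hp rfl
      refine steps_map_append (ih k) ?_ ?_ trivial
      · intro l _ l' h
        rw [nextChoice_cons, h]; rfl
      · intro l hl h
        rw [nextChoice_cons, h]
        rcases hp with hp | rfl
        · simp [hp]
        · simp [(mem_choices.1 hl).2.2, ble_eq_decide]
    cases a with
    | false => simpa [choices] using key (false, false) k [] (by simp) rfl
    | true =>
      cases k with
      | zero => simpa [choices] using key (true, false) 0 [] (by simp) rfl
      | succ k =>
        refine steps_map_append (ih _) ?_ ?_ (by
          simpa using key (true, true) k [] (by simp) rfl)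
        · intro l _ l' h
          rw [nextChoice_cons, h]; rfl
        · intro l hl h
          have hl' := mem_choices.1 hl
          -- The run `choices m (k + 1)` contains `l`, so `m` has enough admissible positions and
          -- the second block is nonempty.
          have hk : k ≤ m.count true := by
            by_contra hk
            have := head?_choices m (k + 1)
            rw [if_neg (by omega)] at this
            cases hc : choices m (k + 1) <;> simp_all
          rw [nextChoice_cons, h, head?_map, head?_choices, if_pos hk, hl'.2.2]
          simp [← hl'.1, ble_eq_decide]

theorem nodup_choices (m : List Bool) (k : ℕ) : (choices m k).Nodup := by
  have inj : ∀ p : Bool × Bool, Function.Injective (p :: · : List (Bool × Bool) → _) :=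
    fun p => cons_injective
  induction m generalizing k with
  | nil => cases k <;> simp [choices]
  | cons a m ih =>
    cases a with
    | false => exact (ih k).map (inj _)
    | true =>
      cases k with
      | zero => exact (ih 0).map (inj _)
      | succ k =>
        refine ((ih _).map (inj _)).append ((ih _).map (inj _)) fun l hl hl' => ?_
        simp only [mem_map] at hl hl'
        obtain ⟨_, _, rfl⟩ := hl
        obtain ⟨_, _, h⟩ := hl'
        simp at h

theorem sz_choice_le (l : List (Bool × Bool)) : sz l ≤ l.length * 8 + 1 :=
  sz_le_of_forall fun p _ => by
    have := sz_bool_le p.1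
    have := sz_bool_le p.2
    rw [← Prod.mk.eta (p := p), sz_pair]
    omega

section
variable {α : Type} [Enc α]

@[fun_prop]
theorem PolyTime.weight {l : α → List (Bool × Bool)} (hl : PolyTime l) :
    PolyTime (fun a => weight (l a)) := by
  unfold PolyDelay.weight
  fun_prop

@[fun_prop]
theorem PolyTime.firstChoice {m : α → List Bool} {k : α → ℕ} (hm : PolyTime m)
    (hk : PolyTime k) : PolyTime (fun a => firstChoice (m a) (k a)) := by
  obtain ⟨q, hq⟩ := hm.size_bound
  obtain ⟨q', hq'⟩ := hk.size_bound
  refine foldr (f := fun _ a d => bif a && Nat.ble 1 d.1 then (d.1 - 1, (a, true) :: d.2)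
    else (d.1, (a, false) :: d.2)) hm (i := fun a => (k a, ([] : List (Bool × Bool))))
    (by fun_prop) (by fun_prop) ⟨q' + q * 8 + 2, fun a l hl => ?_⟩
  change sz (PolyDelay.firstChoice l (k a)) ≤ _
  have h₁ := firstChoice_fst l (k a)
  have h₂ := sz_choice_le (PolyDelay.firstChoice l (k a)).2
  have h₃ := hq a
  have h₄ := hq' a
  have h₅ := length_le_sz (m a)
  have h₆ := hl.length_le
  rw [firstChoice_length] at h₂
  rw [← Prod.mk.eta (p := PolyDelay.firstChoice l (k a)), sz_pair, h₁]
  simp only [sz_nat, Polynomial.eval_add, Polynomial.eval_mul, Polynomial.eval_ofNat] at *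
  omega

theorem nextChoice_length {l l' : List (Bool × Bool)} (h : nextChoice l = some l') :
    l'.length = l.length := by
  induction l generalizing l' with
  | nil => simp [nextChoice, nextChoiceAux] at h
  | cons p l ih =>
    rw [nextChoice_cons] at h
    cases hn : nextChoice l with
    | none =>
      simp only [hn, Option.elim_none] at h
      cases hc : p.1 && !p.2 && Nat.ble 1 (weight l)
      · simp [hc] at h
      · simp only [hc, cond_true, Option.some.injEq] at h
        simp [← h, firstChoice_length]
    | some l'' =>
      simp only [hn, Option.elim_some, Option.some.injEq] at h
      simp [← h, ih hn]

@[fun_prop]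
theorem PolyTime.nextChoice {l : α → List (Bool × Bool)} (hl : PolyTime l) :
    PolyTime (fun a => nextChoice (l a)) := by
  obtain ⟨q, hq⟩ := hl.size_bound
  refine snd (foldr (f := fun _ p d => (p :: d.1, d.2.elim
    (bif p.1 && !p.2 && Nat.ble 1 (PolyDelay.weight d.1) then
      Option.some ((true, true) :: (PolyDelay.firstChoice (d.1.map fun p => p.1)
        (PolyDelay.weight d.1 - 1)).2) else none)
    fun l => Option.some (p :: l))) hl
    (i := fun _ => (([], none) : List (Bool × Bool) × Option (List (Bool × Bool))))
    (by fun_prop) ?_ ⟨q * 16 + 5, fun a l' hl' => ?_⟩)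
  · refine prodMk (by fun_prop) (optionElim ?_ ?_ ?_) <;> fun_prop
  · change sz (nextChoiceAux l') ≤ _
    rw [← Prod.mk.eta (p := nextChoiceAux l'), sz_pair, nextChoiceAux_fst]
    have h₁ := sz_choice_le l'
    have h₂ := hq a
    have h₃ := (hl'.length_le).trans (length_le_sz (l a))
    have h₄ : sz (nextChoiceAux l').2 ≤ l'.length * 8 + 3 := by
      change sz (PolyDelay.nextChoice l') ≤ _
      cases h : PolyDelay.nextChoice l' with
      | none => simp
      | some l'' =>
        have h₅ := sz_choice_le l''
        rw [nextChoice_length h] at h₅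
        simpa using h₅
    simp only [Polynomial.eval_add, Polynomial.eval_mul, Polynomial.eval_ofNat]
    omega

end

/-! ### Computing a matching by an auction -/

/-- The invariant of the auction: `o c = h + 1` if `c` is assigned to `h`, and `o c = 0` if `c` is
not assigned; `p c` is the price of `c`. -/
structure AuctionInv (nb : ℕ → ℕ → Prop) (o p : ℕ → ℕ) : Prop where
  own : ∀ {h c}, o c = h + 1 → nb h c
  inj : ∀ {h c c'}, o c = h + 1 → o c' = h + 1 → c = c'
  -- Approximate complementary slackness: a vertex is bought when it is cheapest, its price then
  -- rises by one, and other prices never fall.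
  near : ∀ {h c c'}, o c = h + 1 → nb h c' → p c ≤ p c' + 1
  zero : ∀ {c}, o c = 0 → p c = 0

/-- Let `B k` be the set of heads all of whose neighbours cost at least `k`. For `k ≥ 1` the mates
under `m` of the heads in `B k` have positive prices, hence distinct owners, and by `near` these
owners lie in `B (k - 1)`. The unassigned head `h₀` lies there too and is not an owner, so `B` grows
by at least one at each step down from `q` to `0`. -/
theorem AuctionInv.price_lt {nb : ℕ → ℕ → Prop} {o p : ℕ → ℕ} (I : AuctionInv nb o p)
    {Hs : Finset ℕ} (hHs : ∀ {h c}, nb h c → h ∈ Hs) {m : ℕ → ℕ} (hm : ∀ h ∈ Hs, nb h (m h))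
    (hinj : Set.InjOn m Hs) {h₀ : ℕ} (h₀_mem : h₀ ∈ Hs) (h₀_free : ∀ c, o c ≠ h₀ + 1) {q : ℕ}
    (hq : ∀ c, nb h₀ c → q ≤ p c) : q + 1 ≤ Hs.card := by
  classical
  let B : ℕ → Finset ℕ := fun k => Hs.filter fun h => ∀ c, nb h c → k ≤ p c
  have hB : ∀ j ≤ q, (B q).card + j ≤ (B (q - j)).card := by
    intro j
    induction j with
    | zero => simp
    | succ j ih =>
      intro hj
      have ih := ih (by omega)
      suffices (B (q - j)).card + 1 ≤ (B (q - (j + 1))).card by omega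
      -- The mate costs at least `q - j`, which is positive because `j + 1 ≤ q`; only assigned
      -- vertices have positive price.
      have howner : ∀ h ∈ B (q - j), ∃ h', o (m h) = h' + 1 := by
        intro h hh
        simp only [B, Finset.mem_filter] at hh
        have h₁ := hh.2 _ (hm h hh.1)
        refine Nat.exists_eq_succ_of_ne_zero fun h0 => ?_
        have := I.zero h0
        omega
      have hsub : insert h₀ ((B (q - j)).image fun h => o (m h) - 1) ⊆ B (q - (j + 1)) := by
        intro x hx
        rw [Finset.mem_insert, Finset.mem_image] at hx
        rcases hx with rfl | ⟨h, hh, rfl⟩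
        · simp only [B, Finset.mem_filter]
          exact ⟨h₀_mem, fun c hc => (Nat.sub_le _ _).trans (hq c hc)⟩
        · obtain ⟨h', hh'⟩ := howner h hh
          simp only [B, Finset.mem_filter] at hh ⊢
          rw [hh', Nat.add_sub_cancel]
          refine ⟨hHs (I.own hh'), fun c hc => ?_⟩
          have h₁ := I.near hh' hc
          have h₂ := hh.2 _ (hm h hh.1)
          omega
      have hcard := Finset.card_le_card hsub
      rw [Finset.card_insert_of_notMem, Finset.card_image_of_injOn] at hcard
      · exact hcard
      · intro h hh g hg he
        obtain ⟨h', hh'⟩ := howner h hh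
        obtain ⟨g', hg'⟩ := howner g hg
        simp only [hh', hg', Nat.add_sub_cancel] at he
        subst he
        simp only [B, Finset.coe_filter, Set.mem_ofPred_eq] at hh hg
        exact hinj hh.1 hg.1 (I.inj hh' hg')
      · rw [Finset.mem_image]
        rintro ⟨h, hh, he⟩
        obtain ⟨h', hh'⟩ := howner h hh
        rw [hh', Nat.add_sub_cancel] at he
        exact h₀_free _ (he ▸ hh')
  have h₁ := hB q le_rfl
  have h₂ : 0 < (B q).card := Finset.card_pos.2 ⟨h₀, by
    simp only [B, Finset.mem_filter]; exact ⟨h₀_mem, hq⟩⟩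
  have h₃ : (B (q - q)).card ≤ Hs.card := Finset.card_filter_le _ _
  omega

theorem AuctionInv.update {nb : ℕ → ℕ → Prop} {o p : ℕ → ℕ} (I : AuctionInv nb o p) {h₀ c₀ : ℕ}
    (h₀_free : ∀ c, o c ≠ h₀ + 1) (hc₀ : nb h₀ c₀) (hmin : ∀ c, nb h₀ c → p c₀ ≤ p c) :
    AuctionInv nb (Function.update o c₀ (h₀ + 1)) (Function.update p c₀ (p c₀ + 1)) where
  own {h c} hc := by
    by_cases h' : c = c₀
    · subst h'
      simp at hc
      exact hc ▸ hc₀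
    · rw [Function.update_of_ne h'] at hc
      exact I.own hc
  inj {h c c'} hc hc' := by
    by_cases h₁ : c = c₀ <;> by_cases h₂ : c' = c₀ <;> simp [h₁, h₂] at hc hc' ⊢
    · subst hc; exact absurd hc' (h₀_free _)
    · subst hc'; exact absurd hc (h₀_free _)
    · exact I.inj hc hc'
  near {h c c'} hc hc' := by
    have mono : p c' ≤ Function.update p c₀ (p c₀ + 1) c' := by
      by_cases h₂ : c' = c₀
      · subst h₂; simp
      · simp [h₂]
    by_cases h₁ : c = c₀
    · subst h₁
      simp at hc
      subst hc
      have := hmin c' hc'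
      simp only [Function.update_self]
      omega
    · simp only [Function.update_of_ne h₁] at hc ⊢
      have := I.near hc hc'
      omega
  zero {c} hc := by
    by_cases h₁ : c = c₀
    · subst h₁; simp at hc
    · rw [Function.update_of_ne h₁] at hc ⊢
      exact I.zero hc

/-- The entry of a list of bits. -/
def bit (l : List Bool) (v : ℕ) : Bool := l.getD v false

/-- The entry of a matrix. -/
def entry (a : List (List Bool)) (u v : ℕ) : Bool := bit (a.getD u []) v

/-- The edges between heads and other vertices. -/
def headEdge (g : List Bool × List (List Bool)) (h c : ℕ) : Bool :=
  bit g.1 h && !(bit g.1 c) && entry g.2 h c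

/-- The first unassigned head, and the number of vertices if there is none. -/
def freeHead (g : List Bool × List (List Bool)) (s : List ℕ × List ℕ) : ℕ :=
  ((range g.1.length).filter fun h =>
    bit g.1 h && (range g.1.length).all fun c => !((s.1.getD c 0).beq (h + 1))).headD g.1.length

/-- The first cheapest neighbour, and the number of vertices if there is none. -/
def cheapest (g : List Bool × List (List Bool)) (s : List ℕ × List ℕ) (h : ℕ) : ℕ :=
  ((range g.1.length).filter fun c => headEdge g h c &&
    (range g.1.length).all fun c' => !(headEdge g h c') ||
      (s.2.getD c 0).ble (s.2.getD c' 0)).headD g.1.length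

/-- The change of the assignment and the prices when `h` obtains `c`. -/
def assign (n : ℕ) (s : List ℕ × List ℕ) (h c : ℕ) : List ℕ × List ℕ :=
  -- The caps at `n` never act when all heads can be matched. They make the size bound of the
  -- iteration hold for every input, without the invariant.
  ((range n).map fun i => min n (bif i.beq c then h + 1 else s.1.getD i 0),
   (range n).map fun i => min n (bif i.beq c then s.2.getD i 0 + 1 else s.2.getD i 0))

/-- One step of the auction. -/
def auctionStep (g : List Bool × List (List Bool)) (s : List ℕ × List ℕ) : List ℕ × List ℕ :=
  assign g.1.length s (freeHead g s) (cheapest g s (freeHead g s))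

/-- The result of the auction: the assignment of the crown vertices to heads. -/
def auction (g : List Bool × List (List Bool)) : List ℕ :=
  -- Each effective step raises the sum of the `n` prices by one, and each price stays at most `n`.
  ((auctionStep g)^[g.1.length * g.1.length + 1] ([], [])).1

section
variable {α : Type} [Enc α]

@[fun_prop]
theorem PolyTime.bit {l : α → List Bool} {v : α → ℕ} (hl : PolyTime l) (hv : PolyTime v) :
    PolyTime (fun a => bit (l a) (v a)) := by
  unfold PolyDelay.bit; fun_prop

@[fun_prop]
theorem PolyTime.entry {l : α → List (List Bool)} {u v : α → ℕ} (hl : PolyTime l)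
    (hu : PolyTime u) (hv : PolyTime v) : PolyTime (fun a => entry (l a) (u a) (v a)) := by
  unfold PolyDelay.entry; fun_prop

@[fun_prop]
theorem PolyTime.headEdge {g : α → List Bool × List (List Bool)} {u v : α → ℕ} (hg : PolyTime g)
    (hu : PolyTime u) (hv : PolyTime v) : PolyTime (fun a => headEdge (g a) (u a) (v a)) := by
  unfold PolyDelay.headEdge; fun_prop

@[fun_prop]
theorem PolyTime.freeHead {g : α → List Bool × List (List Bool)} {s : α → List ℕ × List ℕ}
    (hg : PolyTime g) (hs : PolyTime s) : PolyTime (fun a => freeHead (g a) (s a)) := by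
  unfold PolyDelay.freeHead; fun_prop

@[fun_prop]
theorem PolyTime.cheapest {g : α → List Bool × List (List Bool)} {s : α → List ℕ × List ℕ}
    {h : α → ℕ} (hg : PolyTime g) (hs : PolyTime s) (hh : PolyTime h) :
    PolyTime (fun a => cheapest (g a) (s a) (h a)) := by
  unfold PolyDelay.cheapest; fun_prop

@[fun_prop]
theorem PolyTime.assign {n h c : α → ℕ} {s : α → List ℕ × List ℕ} (hn : PolyTime n)
    (hs : PolyTime s) (hh : PolyTime h) (hc : PolyTime c) :
    PolyTime (fun a => assign (n a) (s a) (h a) (c a)) := by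
  unfold PolyDelay.assign; fun_prop

@[fun_prop]
theorem PolyTime.auction {g : α → List Bool × List (List Bool)} (hg : PolyTime g) :
    PolyTime (fun a => auction (g a)) := by
  suffices h : PolyTime PolyDelay.auction from h.comp hg
  refine PolyTime.fst (iterate (i := fun _ => (([], []) : List ℕ × List ℕ)) (f := auctionStep)
    (by fun_prop) (by fun_prop) (by unfold auctionStep; fun_prop) ?_)
  refine ⟨2 * (.X * (2 * .X + 2) + 1) + 1, fun g k _ => ?_⟩
  have key : ∀ f : ℕ → ℕ, sz ((List.range g.1.length).map fun i => Min.min g.1.length (f i)) ≤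
      sz g * (2 * sz g + 2) + 1 := by
    intro f
    have hle : g.1.length ≤ sz g := by
      have := length_le_sz g.1
      rw [← Prod.mk.eta (p := g), sz_pair]
      dsimp only
      omega
    refine (sz_le_of_forall (n := 2 * sz g + 1) fun x hx => ?_).trans ?_
    · simp only [mem_map] at hx
      obtain ⟨i, -, rfl⟩ := hx
      rw [sz_nat]
      have : Min.min g.1.length (f i) ≤ g.1.length := min_le_left _ _
      omega
    · simp only [length_map, length_range]
      exact Nat.add_le_add_right (Nat.mul_le_mul_right _ hle) _
  cases k with
  | zero => simp
  | succ k =>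
    rw [Function.iterate_succ_apply', auctionStep, PolyDelay.assign, sz_pair]
    simp only [Polynomial.eval_add, Polynomial.eval_mul, Polynomial.eval_X, Polynomial.eval_ofNat,
      Polynomial.eval_one]
    have h₁ := key fun i => bif i.beq (PolyDelay.cheapest g ((auctionStep g)^[k] ([], []))
      (PolyDelay.freeHead g ((auctionStep g)^[k] ([], [])))) then
        PolyDelay.freeHead g ((auctionStep g)^[k] ([], [])) + 1
        else ((auctionStep g)^[k] ([], [])).1.getD i 0
    have h₂ := key fun i => bif i.beq (PolyDelay.cheapest g ((auctionStep g)^[k] ([], []))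
      (PolyDelay.freeHead g ((auctionStep g)^[k] ([], [])))) then
        ((auctionStep g)^[k] ([], [])).2.getD i 0 + 1
        else ((auctionStep g)^[k] ([], [])).2.getD i 0
    omega

end

/-! ### Correctness of the auction -/

theorem headD_filter_range {n : ℕ} (p : ℕ → Bool) :
    (((range n).filter p).headD n < n ∧ p (((range n).filter p).headD n) = true) ∨
      (((range n).filter p).headD n = n ∧ ∀ i < n, p i = false) := by
  cases h : (range n).filter p with
  | nil =>
    refine .inr ⟨rfl, fun i hi => ?_⟩
    simpa using filter_eq_nil_iff.1 h i (mem_range.2 hi)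
  | cons a l =>
    have : a ∈ (range n).filter p := by simp [h]
    exact .inl (by simpa using this)

theorem getD_map_range {α : Type} (n : ℕ) (f : ℕ → α) (i : ℕ) (x : α) :
    ((range n).map f).getD i x = if i < n then f i else x := by
  by_cases h : i < n <;> simp [getD_eq_getElem?_getD, h]

theorem bit_lt {l : List Bool} {v : ℕ} (h : bit l v = true) : v < l.length := by
  by_contra hv
  simp [bit, getD_eq_getElem?_getD, getElem?_eq_none (not_lt.1 hv)] at h

/-- The auction yields a matching that covers all heads, if there is one. -/
theorem auction_spec {g : List Bool × List (List Bool)} {m : ℕ → ℕ}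
    (hm : ∀ h, bit g.1 h = true → m h < g.1.length ∧ headEdge g h (m h) = true)
    (hinj : ∀ h h', bit g.1 h = true → bit g.1 h' = true → m h = m h' → h = h') :
    (∀ h c, (auction g).getD c 0 = h + 1 → c < g.1.length ∧ headEdge g h c = true) ∧
    (∀ h c c', (auction g).getD c 0 = h + 1 → (auction g).getD c' 0 = h + 1 → c = c') ∧
    ∀ h, bit g.1 h = true → ∃ c, (auction g).getD c 0 = h + 1 := by
  obtain ⟨n, hn⟩ : ∃ n, n = g.1.length := ⟨_, rfl⟩
  set nb : ℕ → ℕ → Prop := fun h c => c < n ∧ headEdge g h c = true with hnb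
  have hhead : ∀ {h c}, nb h c → bit g.1 h = true := fun {h c} hc => by
    simp only [hnb, headEdge, Bool.and_eq_true] at hc
    exact hc.2.1.1
  let Good : List ℕ × List ℕ → Prop := fun s =>
    AuctionInv nb (fun c => s.1.getD c 0) (fun c => s.2.getD c 0) ∧
    (∀ c, s.1.getD c 0 ≤ n) ∧ (∀ c, s.2.getD c 0 ≤ n) ∧ ∀ c, n ≤ c → s.2.getD c 0 = 0
  let Full : List ℕ × List ℕ → Prop := fun s => ∀ h, bit g.1 h = true → ∃ c, s.1.getD c 0 = h + 1
  have step : ∀ s, Good s → Good (auctionStep g s) ∧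
      ((Full s ∧ Full (auctionStep g s)) ∨
        ¬Full s ∧ ∑ i ∈ Finset.range n, (auctionStep g s).2.getD i 0 =
          ∑ i ∈ Finset.range n, s.2.getD i 0 + 1) := by
    rintro s ⟨I, ho, hp, hz⟩
    have ho0 : ∀ c, n ≤ c → s.1.getD c 0 = 0 := by
      intro c hc
      by_contra h
      obtain ⟨h', hh'⟩ := Nat.exists_eq_succ_of_ne_zero h
      have := (I.own hh').1
      omega
    rcases headD_filter_range (n := g.1.length) (fun h => bit g.1 h &&
      (range g.1.length).all fun c => !((s.1.getD c 0).beq (h + 1))) with ⟨hlt, hfree⟩ | ⟨heq, hfull⟩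
    · change freeHead g s < _ at hlt
      change (bit g.1 (freeHead g s) && _) = true at hfree
      set h₀ := freeHead g s with hh₀
      rw [Bool.and_eq_true, all_eq_true] at hfree
      have h₀_free : ∀ c, s.1.getD c 0 ≠ h₀ + 1 := by
        intro c hc
        have h₁ := (I.own hc).1
        have h₂ := hfree.2 c (mem_range.2 (hn ▸ h₁))
        change (!((s.1.getD c 0).beq (h₀ + 1))) = true at h₂
        rw [hc] at h₂
        simp at h₂
      rcases headD_filter_range (n := g.1.length) (fun c => headEdge g h₀ c &&
        (range g.1.length).all fun c' => !(headEdge g h₀ c') ||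
        (s.2.getD c 0).ble (s.2.getD c' 0)) with ⟨hclt, hc⟩ | ⟨-, hnone⟩
      · change cheapest g s h₀ < _ at hclt
        change (headEdge g h₀ (cheapest g s h₀) && _) = true at hc
        set c₀ := cheapest g s h₀ with hc₀
        rw [Bool.and_eq_true, all_eq_true] at hc
        have hnb₀ : nb h₀ c₀ := ⟨hn ▸ hclt, hc.1⟩
        have hmin : ∀ c, nb h₀ c → s.2.getD c₀ 0 ≤ s.2.getD c 0 := by
          intro c hcc
          have h₂ := hc.2 c (mem_range.2 (hn ▸ hcc.1))
          change (!(headEdge g h₀ c) || Nat.ble (s.2.getD c₀ 0) (s.2.getD c 0)) = true at h₂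
          rw [hcc.2] at h₂
          simpa [-getD_eq_getElem?_getD] using h₂
        -- The price bound for cheapest neighbours of free heads shows that the cap does not
        -- interfere with the new price.
        have hlt' : s.2.getD c₀ 0 + 1 ≤ n := by
          have := I.price_lt (Hs := (Finset.range n).filter fun h => bit g.1 h = true)
            (fun {h c} hc => by simpa [hn, hhead hc] using bit_lt (hhead hc))
            (m := m) (fun h hh => by
              simp only [Finset.mem_filter] at hh
              exact ⟨hn.symm ▸ (hm h hh.2).1, (hm h hh.2).2⟩)
            (fun h hh h' hh' => by
              simp only [Finset.coe_filter, Set.mem_ofPred_eq] at hh hh'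
              exact hinj h h' hh.2 hh'.2)
            (h₀ := h₀) (by simpa [hfree.1] using hn ▸ hlt) h₀_free hmin
          refine this.trans ((Finset.card_filter_le _ _).trans (by simp))
        have e₁ : (fun c => (auctionStep g s).1.getD c 0) =
            Function.update (fun c => s.1.getD c 0) c₀ (h₀ + 1) := by
          funext c
          change (((range g.1.length).map fun i => min g.1.length
            (bif i.beq c₀ then h₀ + 1 else s.1.getD i 0))).getD c 0 = _
          rw [getD_map_range]
          by_cases hcc : c = c₀
          · subst hcc
            rw [if_pos hclt]
            simp
            omega
          · rw [Function.update_of_ne hcc]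
            have : c.beq c₀ = false := by rw [Bool.eq_false_iff, ne_eq, Nat.beq_eq]; exact hcc
            rw [this, cond_false, ← hn]
            split_ifs with h
            · exact min_eq_right (ho c)
            · exact (ho0 c (by omega)).symm
        have e₂ : (fun c => (auctionStep g s).2.getD c 0) =
            Function.update (fun c => s.2.getD c 0) c₀ (s.2.getD c₀ 0 + 1) := by
          funext c
          change (((range g.1.length).map fun i => min g.1.length
            (bif i.beq c₀ then s.2.getD i 0 + 1 else s.2.getD i 0))).getD c 0 = _
          rw [getD_map_range]
          by_cases hcc : c = c₀
          · subst hcc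
            rw [if_pos hclt, Function.update_self, Nat.beq_refl, cond_true]
            exact min_eq_right (hn ▸ hlt')
          · rw [Function.update_of_ne hcc]
            have : c.beq c₀ = false := by rw [Bool.eq_false_iff, ne_eq, Nat.beq_eq]; exact hcc
            rw [this, cond_false, ← hn]
            split_ifs with h
            · exact min_eq_right (hp c)
            · exact (hz c (by omega)).symm
        refine ⟨⟨?_, fun c => ?_, fun c => ?_, fun c hc => ?_⟩,
          .inr ⟨fun hF => ?_, ?_⟩⟩
        · rw [e₁, e₂]
          exact I.update h₀_free hnb₀ hmin
        · rw [congrFun e₁ c]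
          by_cases hcc : c = c₀
          · subst hcc; simp; omega
          · rw [Function.update_of_ne hcc]; exact ho c
        · rw [congrFun e₂ c]
          by_cases hcc : c = c₀
          · subst hcc; rw [Function.update_self]; exact hlt'
          · rw [Function.update_of_ne hcc]; exact hp c
        · rw [congrFun e₂ c, Function.update_of_ne (by omega)]
          exact hz c hc
        · obtain ⟨c, hc⟩ := hF h₀ hfree.1
          exact h₀_free c hc
        · have hmem : c₀ ∈ Finset.range n := by simpa using hnb₀.1
          rw [Finset.sum_congr rfl fun c _ => congrFun e₂ c, Finset.sum_update_of_mem hmem,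
            ← Finset.add_sum_erase _ _ hmem, Finset.sdiff_singleton_eq_erase]
          omega
      -- `m h₀` is a neighbour of `h₀`, so a cheapest neighbour exists and the search cannot fail.
      · exfalso
        obtain ⟨c₁, hc₁, hmin⟩ := Finset.exists_min_image
          ((Finset.range n).filter fun c => headEdge g h₀ c = true) (fun c => s.2.getD c 0)
          ⟨m h₀, by
            have := hm h₀ hfree.1
            simp [this.2, hn, this.1]⟩
        simp only [Finset.mem_filter, Finset.mem_range] at hc₁ hmin
        have := hnone c₁ (hn ▸ hc₁.1)
        rw [hc₁.2, Bool.true_and, all_eq_false] at this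
        obtain ⟨c', hc', h'⟩ := this
        simp [-getD_eq_getElem?_getD] at h' hc'
        have := hmin c' ⟨hn ▸ hc', h'.1⟩
        omega
    · change freeHead g s = _ at heq
      -- When no head is free, the default `n` stands for the head. It has no neighbours, so the
      -- vertex is the default `n` as well, and the assignment at the nonexistent position `n`
      -- changes nothing.
      have hcn : cheapest g s (freeHead g s) = g.1.length := by
        have hb : bit g.1 (freeHead g s) = false := by
          rw [heq, Bool.eq_false_iff]
          exact fun h => lt_irrefl _ (bit_lt h)
        simp [cheapest, headEdge, hb]
      have e₁ : (fun c => (auctionStep g s).1.getD c 0) = fun c => s.1.getD c 0 := by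
        funext c
        rw [auctionStep, assign, getD_map_range, hcn, ← hn]
        split_ifs with h
        · have : c.beq n = false := by rw [Bool.eq_false_iff, ne_eq, Nat.beq_eq]; omega
          rw [this]
          exact min_eq_right (ho c)
        · exact (ho0 c (by omega)).symm
      have e₂ : (fun c => (auctionStep g s).2.getD c 0) = fun c => s.2.getD c 0 := by
        funext c
        rw [auctionStep, assign, getD_map_range, hcn, ← hn]
        split_ifs with h
        · have : c.beq n = false := by rw [Bool.eq_false_iff, ne_eq, Nat.beq_eq]; omega
          rw [this]
          exact min_eq_right (hp c)
        · exact (hz c (by omega)).symm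
      have hF : Full s := by
        intro h hh
        have := hfull h (bit_lt hh)
        rw [hh, Bool.true_and, all_eq_false] at this
        obtain ⟨c, -, hc⟩ := this
        exact ⟨c, by simpa [-getD_eq_getElem?_getD] using hc⟩
      refine ⟨⟨by rw [e₁, e₂]; exact I, fun c => (congrFun e₁ c).trans_le (ho c),
        fun c => (congrFun e₂ c).trans_le (hp c), fun c hc => (congrFun e₂ c).trans (hz c hc)⟩,
        .inl ⟨hF, fun h hh => ?_⟩⟩
      obtain ⟨c, hc⟩ := hF h hh
      exact ⟨c, (congrFun e₁ c).trans hc⟩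
  -- As long as some head is free, the number of steps is bounded by the sum of the prices.
  have run : ∀ k, Good ((auctionStep g)^[k] ([], [])) ∧ (Full ((auctionStep g)^[k] ([], [])) ∨
      k ≤ ∑ i ∈ Finset.range n, ((auctionStep g)^[k] ([], [])).2.getD i 0) := by
    intro k
    induction k with
    | zero =>
      refine ⟨⟨⟨?_, ?_, ?_, ?_⟩, ?_, ?_, ?_⟩, .inr (Nat.zero_le _)⟩ <;> simp
    | succ k ih =>
      rw [Function.iterate_succ_apply']
      obtain ⟨h₁, h₂⟩ := step _ ih.1
      refine ⟨h₁, ?_⟩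
      rcases h₂ with h₂ | h₂
      · exact .inl h₂.2
      · rcases ih.2 with h₃ | h₃
        · exact absurd h₃ h₂.1
        · exact .inr (by have := h₂.2; omega)
  obtain ⟨⟨I, -, hp, -⟩, h₂⟩ := run (g.1.length * g.1.length + 1)
  refine ⟨fun h c hc => hn ▸ I.own hc, fun h c c' hc hc' => I.inj hc hc', ?_⟩
  rcases h₂ with h₂ | h₂
  · exact h₂
  · have := Finset.sum_le_card_nsmul (Finset.range n) _ n fun i _ => hp i
    simp only [Finset.card_range, smul_eq_mul] at this
    rw [← hn] at *
    omega

/-! ### The gadget -/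

/-- Head and edges of a crowned graph, the matching, and the chosen crown vertices. -/
abbrev State := (List Bool × List (List Bool)) × List ℕ × List (Bool × Bool)

/-- The instances of Enum Crown as they are encoded. -/
abbrev RawInstance := ℕ × List Bool × List Bool × List (List Bool) × Unit

namespace State

/-- The number of vertices. -/
def size (s : State) : ℕ := s.1.1.length

/-- The number of variables: the vertices and two dummies. -/
def vars (s : State) : ℕ := s.1.1.length + 2

/-- The successor of the head that is matched to `c`, and zero if there is none. -/
def owner (s : State) (c : ℕ) : ℕ := s.2.1.getD c 0

/-- Whether a vertex is chosen. -/
def chosen (s : State) (v : ℕ) : Bool := (s.2.2.getD v (false, false)).2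

/-- The negations of the variables of crown vertices that are chosen or unmatched. -/
def forced (s : State) (i : ℕ) : Bool :=
  s.vars.ble i && !(bit s.1.1 (i - s.vars)) &&
    -- The dummies are beyond all lists, so by the default values they count as unmatched non-heads
    -- and are made false.
    ((s.owner (i - s.vars)).beq 0 || s.chosen (i - s.vars))

/-- The edges that remain: at the chosen vertices only those of the matching. -/
def kept (s : State) (u v : ℕ) : Bool :=
  -- The other edges at a chosen vertex are covered by it anyway. Its matching edge stays: as the
  -- variable of the chosen vertex is false, this edge forces the mate.
  entry s.1.2 u v && (!(s.chosen u) || (s.owner u).beq (v + 1)) &&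
    (!(s.chosen v) || (s.owner v).beq (u + 1))

/-- The head of the gadget. -/
def headLit (s : State) (i : ℕ) : Bool :=
  -- Exactly one literal of each variable belongs to the head: the positive one for heads, the
  -- negative one for all others.
  bif (i + 1).ble s.vars then bit s.1.1 i else !(bit s.1.1 (i - s.vars))

/-- The edges of the gadget.  Its vertices are the variables and their negations. -/
def adjLit (s : State) (i j : ℕ) : Bool :=
  -- In this order: forced literals are adjacent to everything, each variable to its negation,
  -- positive literals along kept edges, and negative literals along matching edges, which forbids
  -- that both ends are true.
  !(i.beq j) && (s.forced i || s.forced j || j.beq (i + s.vars) || i.beq (j + s.vars) ||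
    ((i + 1).ble s.vars && (j + 1).ble s.vars && s.kept i j) ||
    (s.vars.ble i && s.vars.ble j && ((s.owner (i - s.vars)).beq (j - s.vars + 1) ||
      (s.owner (j - s.vars)).beq (i - s.vars + 1))))

/-- The gadget as an instance of Enum Small Crown. -/
def build (s : State) : RawInstance :=
  (0, (range (s.vars + s.vars)).map s.headLit, (range (s.vars + s.vars)).map (fun i => !(s.headLit i)),
    (range (s.vars + s.vars)).map (fun i => (range (s.vars + s.vars)).map (s.adjLit i)), ())

/-- The translation of the solutions. -/
def post (a : State × List Bool) : List Bool :=
  -- The dummies and the negative literals are dropped, and the chosen vertices, whose variables are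
  -- false, are put back.
  (range a.1.size).map fun v => bit a.2 v || a.1.chosen v

/-- The state with the following choice. -/
def next (s : State) : Option State :=
  (nextChoice s.2.2).elim none fun X => some (s.1, s.2.1, X)

/-- The state with the first choice. -/
def init (a : RawInstance) : Option State :=
  some ((a.2.1, a.2.2.2.1), auction (a.2.1, a.2.2.2.1), (firstChoice a.2.2.1 a.1).2)

end State

section
variable {α : Type} [Enc α]

@[fun_prop]
theorem PolyTime.vars {s : α → State} (hs : PolyTime s) : PolyTime (fun a => (s a).vars) := by
  unfold State.vars; fun_prop

@[fun_prop]
theorem PolyTime.owner {s : α → State} {c : α → ℕ} (hs : PolyTime s) (hc : PolyTime c) :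
    PolyTime (fun a => (s a).owner (c a)) := by
  unfold State.owner; fun_prop

@[fun_prop]
theorem PolyTime.chosen {s : α → State} {c : α → ℕ} (hs : PolyTime s) (hc : PolyTime c) :
    PolyTime (fun a => (s a).chosen (c a)) := by
  unfold State.chosen; fun_prop

@[fun_prop]
theorem PolyTime.forced {s : α → State} {c : α → ℕ} (hs : PolyTime s) (hc : PolyTime c) :
    PolyTime (fun a => (s a).forced (c a)) := by
  unfold State.forced; fun_prop

@[fun_prop]
theorem PolyTime.kept {s : α → State} {c d : α → ℕ} (hs : PolyTime s) (hc : PolyTime c)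
    (hd : PolyTime d) : PolyTime (fun a => (s a).kept (c a) (d a)) := by
  unfold State.kept; fun_prop

@[fun_prop]
theorem PolyTime.headLit {s : α → State} {c : α → ℕ} (hs : PolyTime s) (hc : PolyTime c) :
    PolyTime (fun a => (s a).headLit (c a)) := by
  unfold State.headLit; fun_prop

@[fun_prop]
theorem PolyTime.adjLit {s : α → State} {c d : α → ℕ} (hs : PolyTime s) (hc : PolyTime c)
    (hd : PolyTime d) : PolyTime (fun a => (s a).adjLit (c a) (d a)) := by
  unfold State.adjLit; fun_prop

theorem PolyTime.build : PolyTime State.build := by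
  unfold State.build; fun_prop

theorem PolyTime.post : PolyTime State.post := by
  unfold State.post State.size; fun_prop

theorem PolyTime.next : PolyTime State.next := by
  unfold State.next
  exact optionElim (by fun_prop) (by fun_prop) (by fun_prop)

theorem PolyTime.init : PolyTime State.init := by
  unfold State.init; fun_prop

end

/-! ### Correctness of the gadget: covers with given defect and covers of literals -/

namespace State

/-- The data of a state come from a crowned graph. -/
structure Valid (s : State) : Prop where
  symm : ∀ {u v}, entry s.1.2 u v = true → entry s.1.2 v u = true
  irrefl : ∀ u, entry s.1.2 u u = false
  lt : ∀ {u v}, entry s.1.2 u v = true → u < s.size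
  crown : ∀ {u v}, entry s.1.2 u v = true → bit s.1.1 u = true ∨ bit s.1.1 v = true
  own : ∀ {h c}, s.owner c = h + 1 → headEdge s.1 h c = true
  inj : ∀ {h c c'}, s.owner c = h + 1 → s.owner c' = h + 1 → c = c'
  full : ∀ {h}, bit s.1.1 h = true → ∃ c, s.owner c = h + 1
  chosen_lt : ∀ {v}, s.chosen v = true → v < s.size
  chosen_crown : ∀ {v}, s.chosen v = true → bit s.1.1 v = false

theorem forced_iff {s : State} {i : ℕ} : s.forced i = true ↔ s.vars ≤ i ∧
    bit s.1.1 (i - s.vars) = false ∧ (s.owner (i - s.vars) = 0 ∨ s.chosen (i - s.vars) = true) := by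
  simp [forced, and_assoc]

theorem kept_iff {s : State} {u v : ℕ} : s.kept u v = true ↔ entry s.1.2 u v = true ∧
    (s.chosen u = true → s.owner u = v + 1) ∧ (s.chosen v = true → s.owner v = u + 1) := by
  cases h₁ : s.chosen u <;> cases h₂ : s.chosen v <;> simp [kept, and_assoc, h₁, h₂]

theorem adjLit_iff {s : State} {i j : ℕ} : s.adjLit i j = true ↔ i ≠ j ∧
    (s.forced i = true ∨ s.forced j = true ∨ j = i + s.vars ∨ i = j + s.vars ∨
      (i < s.vars ∧ j < s.vars ∧ s.kept i j = true) ∨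
      (s.vars ≤ i ∧ s.vars ≤ j ∧
        (s.owner (i - s.vars) = j - s.vars + 1 ∨ s.owner (j - s.vars) = i - s.vars + 1))) := by
  have : i.beq j = false ↔ i ≠ j := by rw [Bool.eq_false_iff, ne_eq, Nat.beq_eq]
  simp [adjLit, or_assoc, and_assoc, this]

theorem headLit_of_lt {s : State} {v : ℕ} (h : v < s.vars) : s.headLit v = bit s.1.1 v := by
  have : (v + 1).ble s.vars = true := by rw [Nat.ble_eq]; exact h
  simp [headLit, this]

theorem headLit_add (s : State) (v : ℕ) : s.headLit (s.vars + v) = !(bit s.1.1 v) := by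
  have : (s.vars + v + 1).ble s.vars = false := by
    rw [Bool.eq_false_iff, ne_eq, Nat.ble_eq]; omega
  simp [headLit, this]

theorem kept_symm {s : State} (hs : s.Valid) {u v : ℕ} (h : s.kept u v = true) :
    s.kept v u = true := by
  rw [kept_iff] at *
  exact ⟨hs.symm h.1, h.2.2, h.2.1⟩

theorem adjLit_symm {s : State} (hs : s.Valid) {i j : ℕ} (h : s.adjLit i j = true) :
    s.adjLit j i = true := by
  rw [adjLit_iff] at *
  obtain ⟨h₁, h⟩ := h
  refine ⟨h₁.symm, ?_⟩
  rcases h with h | h | h | h | h | h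
  · exact .inr (.inl h)
  · exact .inl h
  · exact .inr (.inr (.inr (.inl h)))
  · exact .inr (.inr (.inl h))
  · exact .inr (.inr (.inr (.inr (.inl ⟨h.2.1, h.1, kept_symm hs h.2.2⟩))))
  · exact .inr (.inr (.inr (.inr (.inr ⟨h.2.1, h.1, h.2.2.symm⟩))))

theorem Valid.own' {s : State} (hs : s.Valid) {h c : ℕ} (hc : s.owner c = h + 1) :
    bit s.1.1 h = true ∧ bit s.1.1 c = false ∧ entry s.1.2 h c = true ∧ h < s.size ∧
      c < s.size := by
  have := hs.own hc
  simp only [headEdge, Bool.and_eq_true, Bool.not_eq_true'] at this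
  exact ⟨this.1.1, this.1.2, this.2, hs.lt this.2, hs.lt (hs.symm this.2)⟩

/-- Each edge of the gadget has an end in its head. -/
theorem headLit_or {s : State} (hs : s.Valid) {i j : ℕ} (hi : i < s.vars + s.vars)
    (hj : j < s.vars + s.vars) (h : s.adjLit i j = true) :
    s.headLit i = true ∨ s.headLit j = true := by
  have hf : ∀ i, s.forced i = true → s.headLit i = true := by
    intro i h
    rw [forced_iff] at h
    obtain ⟨v, rfl⟩ := Nat.exists_eq_add_of_le h.1
    rw [Nat.add_sub_cancel_left] at h
    simp [headLit_add, h.2.1]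
  have hp : ∀ i, i < s.vars → s.headLit i = true ∨ s.headLit (s.vars + i) = true := by
    intro i hi
    rw [headLit_add, headLit_of_lt hi]
    cases bit s.1.1 i <;> simp
  rw [adjLit_iff] at h
  obtain ⟨-, h | h | rfl | rfl | ⟨h₁, h₂, h⟩ | ⟨h₁, h₂, h⟩⟩ := h
  · exact .inl (hf i h)
  · exact .inr (hf j h)
  · rw [add_comm i]; exact hp i (by omega)
  · rw [add_comm j]; exact (hp j (by omega)).symm
  · rw [headLit_of_lt h₁, headLit_of_lt h₂]
    exact hs.crown (kept_iff.1 h).1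
  · obtain ⟨u, rfl⟩ := Nat.exists_eq_add_of_le h₁
    obtain ⟨v, rfl⟩ := Nat.exists_eq_add_of_le h₂
    simp only [Nat.add_sub_cancel_left] at h
    rw [headLit_add, headLit_add]
    rcases h with h | h
    · simp [(hs.own' h).2.1]
    · simp [(hs.own' h).2.1]

/-- The crown vertices in `S` whose matched head, if there is one, is in `S` as well. -/
def Defect (s : State) (S : ℕ → Prop) (v : ℕ) : Prop :=
  S v ∧ bit s.1.1 v = false ∧ ∀ h, s.owner v = h + 1 → S h

/-- `S` is a vertex cover whose defect is the chosen set. -/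
structure Fits (s : State) (S : ℕ → Prop) : Prop where
  cover : ∀ u v, entry s.1.2 u v = true → S u ∨ S v
  defect : ∀ v, s.chosen v = true ↔ s.Defect S v

/-- The set of literals that corresponds to a set of vertices. -/
structure IsLift (s : State) (S T : ℕ → Prop) : Prop where
  pos : ∀ v < s.vars, T v ↔ S v ∧ s.chosen v = false
  neg : ∀ v < s.vars, T (s.vars + v) ↔ ¬ T v

/-- From covers to the gadget: the variable of a chosen vertex is false by definition, and an
unmatched or doubly covered crown vertex outside the chosen set would be an additional defect. -/
theorem IsLift.cover {s : State} (hs : s.Valid) {S T : ℕ → Prop} (hT : s.IsLift S T)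
    (hS : s.Fits S) {i j : ℕ} (hi : i < s.vars + s.vars)
    (hj : j < s.vars + s.vars) (h : s.adjLit i j = true) : T i ∨ T j := by
  have hf : ∀ i < s.vars + s.vars, s.forced i = true → T i := by
    intro i hi h
    rw [forced_iff] at h
    obtain ⟨v, rfl⟩ := Nat.exists_eq_add_of_le h.1
    rw [Nat.add_sub_cancel_left] at h
    rw [hT.neg v (by omega), hT.pos v (by omega)]
    rintro ⟨h₁, h₂⟩
    rcases h.2.2 with h₃ | h₃
    · have : s.Defect S v := ⟨h₁, h.2.1, fun h h' => by omega⟩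
      rw [← hS.defect, h₂] at this
      exact absurd this (by simp)
    · simp [h₂] at h₃
  have hk : ∀ u v, u < s.vars → v < s.vars → s.kept u v = true → S u → T u ∨ T v := by
    intro u v hu hv h hSu
    rw [kept_iff] at h
    rw [hT.pos u hu, hT.pos v hv]
    cases hc : s.chosen u with
    | false => exact .inl ⟨hSu, rfl⟩
    | true =>
      -- The kept edge at a chosen `u` is its matching edge. Its other end is in `S` because `u` is
      -- a defect, and it is a head, hence not chosen.
      have ho := h.2.1 hc
      refine .inr ⟨((hS.defect u).1 hc).2.2 v ho, ?_⟩
      by_contra h'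
      have := hs.chosen_crown (Bool.not_eq_false _ ▸ h')
      simp [(hs.own' ho).1] at this
  have hm : ∀ u v, v < s.vars → u < s.vars → s.owner u = v + 1 →
      T (s.vars + u) ∨ T (s.vars + v) := by
    intro u v hv hu ho
    rw [hT.neg u hu, hT.neg v hv, hT.pos u hu, hT.pos v hv, ← not_and_or]
    rintro ⟨⟨h₁, h₂⟩, h₃, -⟩
    have : s.Defect S u := ⟨h₁, (hs.own' ho).2.1, fun h h' => by
      rw [ho, Nat.add_right_cancel_iff] at h'
      exact h' ▸ h₃⟩
    rw [← hS.defect, h₂] at this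
    exact absurd this (by simp)
  rw [adjLit_iff] at h
  obtain ⟨-, h | h | rfl | rfl | ⟨h₁, h₂, h⟩ | ⟨h₁, h₂, h⟩⟩ := h
  · exact .inl (hf i hi h)
  · exact .inr (hf j hj h)
  · rw [add_comm i, hT.neg i (by omega)]; exact em _
  · rw [add_comm j, hT.neg j (by omega)]; exact (em _).symm
  · rcases hS.cover i j (kept_iff.1 h).1 with h' | h'
    · exact hk i j h₁ h₂ h h'
    · exact (hk j i h₂ h₁ (kept_symm hs h) h').symm
  · obtain ⟨u, rfl⟩ := Nat.exists_eq_add_of_le h₁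
    obtain ⟨v, rfl⟩ := Nat.exists_eq_add_of_le h₂
    simp only [Nat.add_sub_cancel_left] at h
    rcases h with h | h
    · exact hm u v (by omega) (by omega) h
    · exact (hm v u (by omega) (by omega) h).symm

/-- From the gadget to covers: a consistent cover of the literals, with the chosen vertices added,
is a vertex cover whose defects are exactly the chosen vertices. -/
theorem exists_isLift {s : State} (hs : s.Valid) {T : ℕ → Prop}
    (hT : ∀ v < s.vars, T (s.vars + v) ↔ ¬ T v)
    (hcover : ∀ i j, i < s.vars + s.vars → j < s.vars + s.vars → s.adjLit i j = true → T i ∨ T j) :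
    s.Fits (fun v => v < s.size ∧ T v ∨ s.chosen v = true) ∧
      s.IsLift (fun v => v < s.size ∧ T v ∨ s.chosen v = true) T := by
  have hn : s.vars = s.size + 2 := rfl
  have hf : ∀ v < s.vars, s.forced (s.vars + v) = true → ¬ T v := by
    intro v hv h
    -- A second variable always exists thanks to the two dummies, even when `v` is itself a dummy.
    obtain ⟨u, hu, huv⟩ : ∃ u < s.vars, u ≠ v := by
      by_cases hv : v = 0
      · exact ⟨1, by omega, by omega⟩
      · exact ⟨0, by omega, by omega⟩
    -- A forced literal outside `T` would require both literals of `u` to be in `T`.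
    have h₁ := hcover (s.vars + v) u (by omega) (by omega)
      (adjLit_iff.2 ⟨by omega, .inl h⟩)
    have h₂ := hcover (s.vars + v) (s.vars + u) (by omega) (by omega)
      (adjLit_iff.2 ⟨by omega, .inl h⟩)
    rw [hT v hv] at h₁ h₂
    rw [hT u hu] at h₂
    tauto
  have hforced : ∀ v < s.vars, bit s.1.1 v = false → (s.owner v = 0 ∨ s.chosen v = true) →
      ¬ T v := fun v hv h₁ h₂ => hf v hv (forced_iff.2 ⟨by omega, by simpa using ⟨h₁, h₂⟩⟩)
  have hchosen : ∀ v, s.chosen v = true → ¬ T v := fun v hv =>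
    hforced v (by have := hs.chosen_lt hv; omega) (hs.chosen_crown hv) (.inr hv)
  have hk : ∀ u v, s.kept u v = true → T u ∨ T v := by
    intro u v h
    have h₁ := (kept_iff.1 h).1
    have h₂ := hs.lt h₁
    have h₃ := hs.lt (hs.symm h₁)
    have huv : u ≠ v := by rintro rfl; simp [hs.irrefl] at h₁
    exact hcover u v (by omega) (by omega) (adjLit_iff.2 ⟨huv, .inr (.inr (.inr (.inr (.inl
      ⟨by omega, by omega, h⟩))))⟩)
  refine ⟨⟨fun u v h => ?_, fun v => ⟨fun h => ⟨.inr h, hs.chosen_crown h, fun w hw => ?_⟩, ?_⟩⟩,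
    ⟨fun v hv => ?_, hT⟩⟩
  · by_cases hu : s.chosen u = true
    · exact .inl (.inr hu)
    by_cases hv : s.chosen v = true
    · exact .inr (.inr hv)
    exact (hk u v (kept_iff.2 ⟨h, fun h' => absurd h' hu, fun h' => absurd h' hv⟩)).imp
      (fun h' => .inl ⟨hs.lt h, h'⟩) (fun h' => .inl ⟨hs.lt (hs.symm h), h'⟩)
  · have ho := hs.own' hw
    -- The matching edge of the chosen `v` is kept and `v` is false in `T`, so its mate `w` is true.
    refine .inl ⟨ho.2.2.2.1, (hk v w (kept_iff.2 ⟨hs.symm ho.2.2.1, fun _ => hw, fun h' => ?_⟩)).resolve_left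
      (hchosen v h)⟩
    have := hs.chosen_crown h'
    simp [ho.1] at this
  · rintro ⟨h₁, h₂, h₃⟩
    by_contra hc
    have hTv := (h₁.resolve_right hc)
    have h₀ : s.owner v ≠ 0 := fun h => hforced v (by omega) h₂ (.inl h) hTv.2
    obtain ⟨w, hw⟩ := Nat.exists_eq_succ_of_ne_zero h₀
    have ho := hs.own' hw
    have hTw : T w := by
      refine ((h₃ w hw).resolve_right fun h' => ?_).2
      have := hs.chosen_crown h'
      simp [ho.1] at this
    have hvw : v ≠ w := by
      rintro rfl
      simp [ho.1] at ho
    -- An unchosen defect `v` and its mate `w` would both be true, against the edge between their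
    -- negations.
    have := hcover (s.vars + v) (s.vars + w) (by omega) (by omega) (adjLit_iff.2
      ⟨by omega, .inr (.inr (.inr (.inr (.inr ⟨by omega, by omega, by simp [hw]⟩))))⟩)
    rw [hT v (by omega), hT w (by omega)] at this
    tauto
  · by_cases hvs : v < s.size
    · cases hc : s.chosen v with
      | false => simp [hvs]
      | true => simp [hchosen v hc]
    · have hc : s.chosen v = false := by
        by_contra h
        exact hvs (hs.chosen_lt (Bool.not_eq_false _ ▸ h))
      have hb : bit s.1.1 v = false := by
        by_contra h
        exact hvs (bit_lt (Bool.not_eq_false _ ▸ h))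
      have ho : s.owner v = 0 := by
        by_contra h
        obtain ⟨w, hw⟩ := Nat.exists_eq_succ_of_ne_zero h
        exact hvs (hs.own' hw).2.2.2.2
      simp [hvs, hc, hforced v hv hb (.inl ho)]

end State

/-! ### The gadget as a graph -/

theorem card_of_exactly_one {N : ℕ} {T : ℕ → Prop} [DecidablePred T]
    (hT : ∀ v < N, T (N + v) ↔ ¬ T v) :
    (Finset.univ.filter fun i : Fin (N + N) => T i).card = N := by
  rw [Finset.card_filter, Fin.sum_univ_add, ← Finset.sum_add_distrib]
  refine (Finset.sum_congr rfl fun v _ => ?_).trans (b := ∑ v : Fin N, 1) (by simp)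
  simp only [Fin.val_castAdd, Fin.val_natAdd, hT v v.2]
  by_cases h : T v <;> simp [h]

/-- Each of the `N` pairs contributes at least one and the total is `N`, so each contributes exactly
one. This is how a cover of minimum size becomes a truth assignment. -/
theorem exactly_one_of_card {N : ℕ} {T : ℕ → Prop} [DecidablePred T]
    (hT : ∀ v < N, T v ∨ T (N + v))
    (hcard : (Finset.univ.filter fun i : Fin (N + N) => T i).card = N) :
    ∀ v < N, T (N + v) ↔ ¬ T v := by
  rw [Finset.card_filter, Fin.sum_univ_add, ← Finset.sum_add_distrib] at hcard
  have h : ∀ v ∈ (Finset.univ : Finset (Fin N)), 1 ≤ (if T (Fin.castAdd N v) then 1 else 0) +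
      (if T (Fin.natAdd N v) then 1 else 0) := by
    intro v _
    simp only [Fin.val_castAdd, Fin.val_natAdd]
    have := hT v v.2
    split_ifs <;> first | omega | tauto
  have heq := (Finset.sum_eq_sum_iff_of_le h).1 (by simpa using hcard.symm)
  intro v hv
  have h₁ := heq ⟨v, hv⟩ (Finset.mem_univ _)
  simp only [Fin.val_castAdd, Fin.val_natAdd] at h₁
  by_cases h₂ : T v <;> by_cases h₃ : T (N + v) <;> simp [h₂, h₃] at h₁ ⊢

/-- The graph on the literals. -/
def State.graph (s : State) (hs : s.Valid) : SimpleGraph (Fin (s.vars + s.vars)) where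
  Adj i j := s.adjLit i j = true
  symm := ⟨fun _ _ h => State.adjLit_symm hs h⟩
  loopless := ⟨fun _ h => (State.adjLit_iff.1 h).1 rfl⟩

/-- The matching of each variable with its negation. -/
def State.matching (s : State) (hs : s.Valid) : (s.graph hs).Subgraph where
  verts := Set.univ
  Adj i j := (j : ℕ) = i + s.vars ∨ (i : ℕ) = j + s.vars
  adj_sub {i j} h := by
    have : 0 < s.vars := Nat.succ_pos _
    refine State.adjLit_iff.2 ⟨by omega, ?_⟩
    rcases h with h | h
    · exact .inr (.inr (.inl h))
    · exact .inr (.inr (.inr (.inl h)))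
  edge_vert _ := trivial
  symm := ⟨fun _ _ h => h.symm⟩

theorem State.isCrowned {s : State} (hs : s.Valid) :
    IsCrowned (s.graph hs) (Finset.univ.filter fun i => s.headLit i = true)
      (Finset.univ.filter fun i => s.headLit i = false) ∧
    (Finset.univ.filter fun i : Fin (s.vars + s.vars) => s.headLit i = true).card = s.vars ∧
    (Finset.univ.filter fun i : Fin (s.vars + s.vars) => s.headLit i = false).card = s.vars := by
  have hlit : ∀ v < s.vars, s.headLit (s.vars + v) = !(s.headLit v) := fun v hv => by
    rw [headLit_add, headLit_of_lt hv]
  have c₁ := card_of_exactly_one (N := s.vars) (T := fun i => s.headLit i = true)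
    fun v hv => by rw [hlit v hv]; simp
  have c₂ := card_of_exactly_one (N := s.vars) (T := fun i => s.headLit i = false)
    fun v hv => by rw [hlit v hv]; simp
  refine ⟨⟨?_, ?_, ?_, s.matching hs, ?_, ?_, ?_⟩, c₁, c₂⟩
  · rw [Finset.disjoint_filter]
    intro i _ h
    simp [h]
  · ext i
    cases h : s.headLit i <;> simp [h]
  · intro i hi j hj _ h
    simp only [Finset.coe_filter, Finset.mem_univ, true_and, Set.mem_ofPred_eq] at hi hj
    have := headLit_or hs i.2 j.2 h
    simp [hi, hj] at this
  · intro i _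
    by_cases hi : (i : ℕ) < s.vars
    · refine ⟨⟨i + s.vars, by omega⟩, .inl rfl, fun j hj => ?_⟩
      apply Fin.ext
      rcases hj with hj | hj
      · exact hj
      · omega
    · refine ⟨⟨i - s.vars, by omega⟩, .inr (by simp; omega), fun j hj => ?_⟩
      apply Fin.ext
      rcases hj with hj | hj
      · omega
      · simp; omega
  · have key : ∀ i j : Fin (s.vars + s.vars), (j : ℕ) = i + s.vars →
        s.headLit j = !(s.headLit i) := by
      intro i j h
      rw [h, add_comm, hlit i (by omega)]
    intro i j h
    simp only [Finset.mem_filter, Finset.mem_univ, true_and]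
    rcases h with h | h
    · rw [key i j h]; cases s.headLit i <;> simp
    · rw [key j i h]; cases s.headLit j <;> simp
  · rw [c₁]
    -- The edges are indexed by the variables, which makes their number equal to that of the heads.
    have : (s.matching hs).edgeSet =
        Set.range fun v : Fin s.vars => s(Fin.castAdd s.vars v, Fin.natAdd s.vars v) := by
      ext e
      induction e with
      | _ i j =>
        rw [SimpleGraph.Subgraph.mem_edgeSet, Set.mem_range]
        constructor
        · rintro (h | h)
          · exact ⟨⟨i, by omega⟩, Sym2.eq_iff.2 (.inl ⟨rfl, Fin.ext (by simp; omega)⟩)⟩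
          · exact ⟨⟨j, by omega⟩, Sym2.eq_iff.2 (.inr ⟨rfl, Fin.ext (by simp; omega)⟩)⟩
        · rintro ⟨v, h⟩
          rw [Sym2.eq_iff] at h
          rcases h with ⟨rfl, rfl⟩ | ⟨rfl, rfl⟩
          · exact .inl (Nat.add_comm _ _)
          · exact .inr (Nat.add_comm _ _)
    rw [this, ← Set.image_univ, Set.ncard_image_of_injective, Set.ncard_univ]
    · simp
    · intro u v h
      simp only [Sym2.eq_iff] at h
      rcases h with h | h
      · exact Fin.ext (by simpa using congrArg Fin.val h.1)
      · have := congrArg Fin.val h.1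
        simp at this
        omega

/-- The gadget as an instance. -/
def State.instance (s : State) (hs : s.Valid) : CrownInstance where
  n := s.vars + s.vars
  G := s.graph hs
  head := Finset.univ.filter fun i => s.headLit i = true
  crown := Finset.univ.filter fun i => s.headLit i = false
  crowned := (State.isCrowned hs).1
  x := 0
  x_le := Nat.zero_le _

/-! ### Encodings -/

/-- The membership bits. -/
def bits {n : ℕ} (S : Finset (Fin n)) : List Bool := ofFn fun v => decide (v ∈ S)

theorem enc_bits {n : ℕ} (S : Finset (Fin n)) : enc (bits S) = encodeSet S := by
  change Data.ofList ((bits S).map enc) = _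
  rw [bits, map_ofFn]
  rfl

open Classical in
/-- The adjacency matrix. -/
noncomputable def matrix {n : ℕ} (G : SimpleGraph (Fin n)) : List (List Bool) :=
  ofFn fun v => ofFn fun w => decide (G.Adj v w)

theorem enc_matrix {n : ℕ} (G : SimpleGraph (Fin n)) : enc (matrix G) = encodeGraph G := by
  change Data.ofList ((matrix G).map enc) = _
  rw [matrix, map_ofFn, encodeGraph]
  congr 2
  funext v
  change Data.ofList (map enc _) = _
  rw [map_ofFn]
  rfl

theorem bit_bits {n : ℕ} (S : Finset (Fin n)) (v : ℕ) :
    bit (bits S) v = true ↔ ∃ h : v < n, (⟨v, h⟩ : Fin n) ∈ S := by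
  by_cases h : v < n <;> simp [bit, bits, getD_eq_getElem?_getD, h]

theorem entry_matrix {n : ℕ} (G : SimpleGraph (Fin n)) (u v : ℕ) :
    entry (matrix G) u v = true ↔ ∃ (hu : u < n) (hv : v < n), G.Adj ⟨u, hu⟩ ⟨v, hv⟩ := by
  by_cases h : u < n <;> by_cases h' : v < n <;>
    simp [entry, bit, matrix, getD_eq_getElem?_getD, h, h']

theorem enc_injective_listBool : Function.Injective (enc : List Bool → Data) := by
  intro l l' h
  induction l generalizing l' with
  | nil => exact ((enc_list_eq_nil l').1 h.symm).symm
  | cons a l ih =>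
    cases l' with
    | nil => exact absurd ((enc_list_eq_nil _).1 h) (by simp)
    | cons b l' =>
      have h : Data.cons (enc a) (enc l) = Data.cons (enc b) (enc l') := h
      rw [Data.cons.injEq] at h
      rw [ih h.2]
      have h₁ := h.1
      cases a <;> cases b <;> simp_all [enc, Data.ofBool]

/-- The lists that describe an instance. -/
noncomputable def CrownInstance.raw (I : CrownInstance) : RawInstance :=
  (I.x, bits I.head, bits I.crown, matrix I.G, ())

/-- The unit at the end of the nested pairs is the empty tree that terminates the list of four
entries. -/
theorem CrownInstance.enc_raw (I : CrownInstance) : enc I.raw = I.encode := by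
  change Data.cons (enc I.x) (.cons (enc (bits I.head)) (.cons (enc (bits I.crown))
    (.cons (enc (matrix I.G)) .nil))) = _
  rw [enc_bits, enc_bits, enc_matrix]
  rfl

theorem map_range_eq_ofFn {α : Type} (n : ℕ) (f : ℕ → α) :
    (range n).map f = ofFn fun i : Fin n => f i := by
  apply ext_getElem <;> simp

theorem bits_filter (n : ℕ) (p : ℕ → Prop) [DecidablePred p] (f : ℕ → Bool)
    (h : ∀ i < n, p i ↔ f i = true) :
    bits (Finset.univ.filter fun i : Fin n => p i) = (range n).map f := by
  rw [map_range_eq_ofFn, bits]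
  congr 1
  funext i
  rw [Bool.eq_iff_iff, decide_eq_true_iff, Finset.mem_filter, h i i.2]
  simp

theorem matrix_graph {s : State} (hs : s.Valid) : matrix (s.graph hs) =
    (range (s.vars + s.vars)).map fun i => (range (s.vars + s.vars)).map (s.adjLit i) := by
  rw [map_range_eq_ofFn, matrix]
  congr 1
  funext i
  rw [map_range_eq_ofFn]
  congr 1
  funext j
  classical
  rw [Bool.eq_iff_iff, decide_eq_true_iff]
  rfl

theorem State.enc_build {s : State} (hs : s.Valid) : (s.instance hs).encode = enc s.build := by
  rw [← CrownInstance.enc_raw]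
  congr 1
  change (0, bits (Finset.univ.filter fun i : Fin (s.vars + s.vars) => s.headLit i = true),
    bits (Finset.univ.filter fun i : Fin (s.vars + s.vars) => s.headLit i = false),
    matrix (s.graph hs), ()) = _
  rw [bits_filter _ (fun i => s.headLit i = true) s.headLit (fun _ _ => Iff.rfl),
    bits_filter _ (fun i => s.headLit i = false) (fun i => !(s.headLit i)) (by simp), matrix_graph]
  rfl

/-! ### The solutions of the gadget -/

namespace State

/-- The bits of the lift of a set of vertices. -/
def liftBit (s : State) (l : List Bool) (i : ℕ) : Bool :=
  if i < s.vars then bit l i && !(s.chosen i) else !(bit l (i - s.vars) && !(s.chosen (i - s.vars)))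

theorem isLift_liftBit (s : State) (l : List Bool) :
    s.IsLift (fun v => bit l v = true) (fun i => s.liftBit l i = true) where
  pos v hv := by simp [liftBit, hv]
  neg v hv := by
    rw [liftBit, if_neg (by omega), liftBit, if_pos hv, Nat.add_sub_cancel_left,
      Bool.not_eq_true', Bool.eq_false_iff]

/-- The lists of bits of the solutions of the gadget. -/
def lifts (s : State) (n : ℕ) : Set (List Bool) :=
  {w | ∃ S : Finset (Fin n), s.Fits (fun v => bit (bits S) v = true) ∧
    w = (range (s.vars + s.vars)).map (s.liftBit (bits S))}

end State

theorem bit_bits_val {n : ℕ} (S : Finset (Fin n)) (v : Fin n) :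
    bit (bits S) v = true ↔ v ∈ S := by
  simp [bit_bits]

theorem bits_length {n : ℕ} (S : Finset (Fin n)) : (bits S).length = n := by simp [bits]

theorem map_bit_bits {n : ℕ} (S : Finset (Fin n)) : (range n).map (bit (bits S)) = bits S := by
  rw [← bits_filter n (fun v => bit (bits S) v = true) _ fun _ _ => Iff.rfl]
  congr 1
  ext v
  simp [bit_bits]

namespace State

/-- The solutions of the gadget. -/
def solutions (s : State) : Set (Finset (Fin (s.vars + s.vars))) :=
  {T | (∀ i j : Fin (s.vars + s.vars), s.adjLit i j = true → i ∈ T ∨ j ∈ T) ∧ T.card = s.vars}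

theorem sol_instance {s : State} (hs : s.Valid) : (s.instance hs).Sol = s.solutions := by
  ext T
  change ((s.graph hs).IsVertexCover _ ∧ T.card = _ + 0) ↔ _
  change (_ ∧ T.card =
    (Finset.univ.filter fun i : Fin (s.vars + s.vars) => s.headLit i = true).card + 0) ↔ _
  rw [(isCrowned hs).2.1, add_zero]
  exact Iff.rfl

/-- Both directions of the correspondence combined: the cardinality condition makes a solution
consistent, and a consistent set is determined by its positive literals, hence by the cover it
lifts. -/
theorem encodeSet_image_solutions {s : State} (hs : s.Valid) :
    encodeSet '' s.solutions = enc '' s.lifts s.size := by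
  ext d
  constructor
  · rintro ⟨T, ⟨hT, hcard⟩, rfl⟩
    have hmem : ∀ i : Fin (s.vars + s.vars), bit (bits T) i = true ↔ i ∈ T := bit_bits_val T
    have hT' : ∀ i j, i < s.vars + s.vars → j < s.vars + s.vars → s.adjLit i j = true →
        bit (bits T) i = true ∨ bit (bits T) j = true := fun i j hi hj h => by
      have := hT ⟨i, hi⟩ ⟨j, hj⟩ h
      rwa [← hmem, ← hmem] at this
    have hfilter : (Finset.univ.filter fun i : Fin (s.vars + s.vars) => bit (bits T) i = true) = T :=
      by ext i; simp [hmem]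
    have h₁ := exactly_one_of_card (N := s.vars) (T := fun i => bit (bits T) i = true)
      (fun v hv => hT' v (s.vars + v) (by omega) (by omega) (adjLit_iff.2
        ⟨by have : 0 < s.vars := Nat.succ_pos _
            omega, .inr (.inr (.inl (add_comm _ _)))⟩))
      (by rw [hfilter, hcard])
    obtain ⟨h₂, h₃⟩ := exists_isLift hs h₁ hT'
    -- The set obtained from `exists_isLift` is a predicate on all numbers; its elements are below
    -- `s.size`, so it comes from a finite set of vertices.
    have hS : (fun v => v < s.size ∧ bit (bits T) v = true ∨ s.chosen v = true) = fun v => bit (bits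
        (Finset.univ.filter fun v : Fin s.size => bit (bits T) v = true ∨ s.chosen v = true)) v
          = true := by
      funext v
      rw [eq_iff_iff]
      refine Iff.trans ?_ (bit_bits _ _).symm
      constructor
      · rintro (h | h)
        · exact ⟨h.1, Finset.mem_filter.2 ⟨Finset.mem_univ _, .inl h.2⟩⟩
        · exact ⟨hs.chosen_lt h, Finset.mem_filter.2 ⟨Finset.mem_univ _, .inr h⟩⟩
      · rintro ⟨h, h'⟩
        exact (Finset.mem_filter.1 h').2.imp_left fun h' => ⟨h, h'⟩
    rw [hS] at h₂ h₃
    refine ⟨_, ⟨_, h₂, rfl⟩, ?_⟩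
    rw [← enc_bits]
    conv_rhs => rw [← map_bit_bits T]
    congr 1
    refine map_congr_left fun i hi => ?_
    rw [mem_range] at hi
    have h₄ := s.isLift_liftBit (bits (Finset.univ.filter fun v : Fin s.size =>
      bit (bits T) v = true ∨ s.chosen v = true))
    rw [Bool.eq_iff_iff]
    by_cases hi' : i < s.vars
    · rw [h₄.pos i hi', h₃.pos i hi']
    · obtain ⟨v, rfl⟩ := Nat.exists_eq_add_of_le (not_lt.1 hi')
      rw [h₄.neg v (by omega), h₃.neg v (by omega), h₄.pos v (by omega), h₃.pos v (by omega)]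
  · rintro ⟨_, ⟨S, hS, rfl⟩, rfl⟩
    have h := s.isLift_liftBit (bits S)
    refine ⟨Finset.univ.filter fun i : Fin (s.vars + s.vars) => s.liftBit (bits S) i = true,
      ⟨fun i j hij => ?_, card_of_exactly_one (T := fun i => s.liftBit (bits S) i = true) h.neg⟩, ?_⟩
    · simpa using h.cover hs hS i.2 j.2 hij
    · rw [← enc_bits, bits_filter _ (fun i => s.liftBit (bits S) i = true) _ fun _ _ => Iff.rfl]

theorem encodeSet_image_sol {s : State} (hs : s.Valid) :
    encodeSet '' (s.instance hs).Sol = enc '' s.lifts s.size := by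
  rw [← encodeSet_image_solutions hs, ← sol_instance hs]
  rfl

/-- Lifting forgets only the chosen vertices, and these are in `S` since they are defects. So `post`
recovers `S`, which yields injectivity and disjointness of the outputs. -/
theorem post_lift {s : State} {S : Finset (Fin s.size)}
    (hS : s.Fits (fun v => bit (bits S) v = true)) :
    post (s, (range (s.vars + s.vars)).map (s.liftBit (bits S))) = bits S := by
  conv_rhs => rw [← map_bit_bits S]
  refine map_congr_left fun v hv => ?_
  rw [mem_range] at hv
  change v < s.size at hv
  have hn : s.vars = s.size + 2 := rfl
  dsimp only
  rw [bit, getD_map_range, if_pos (by omega), liftBit, if_pos (by omega)]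
  cases hc : s.chosen v with
  | false => simp
  | true =>
    have := ((hS.defect v).1 hc).1
    simp only [this]
    simp

end State

/-! ### Counting -/

theorem weight_ofFn {n : ℕ} (f : Fin n → Bool × Bool) :
    weight (ofFn f) = (Finset.univ.filter fun i => (f i).2 = true).card := by
  rw [Finset.card_filter]
  induction n with
  | zero => simp
  | succ n ih =>
    rw [ofFn_succ, Fin.sum_univ_succ, ← ih]
    rcases h : f 0 with ⟨a, _ | _⟩ <;> simp [add_comm]

/-- In a crowned graph, each head has a neighbour in the crown, different ones for different
heads. -/
theorem CrownInstance.exists_mate (I : CrownInstance) : ∃ m : Fin I.n → Fin I.n,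
    (∀ h ∈ I.head, m h ∈ I.crown ∧ I.G.Adj h (m h)) ∧ Set.InjOn m I.head := by
  classical
  obtain ⟨hd, hu, -, M, hM, hMHC, hcard⟩ := I.crowned
  let m : Fin I.n → Fin I.n := fun h => if hc : ∃ c, M.Adj h c then hc.choose else h
  have hm : ∀ h c, M.Adj h c → m h = c := by
    intro h c hc
    have hex : ∃ c, M.Adj h c := ⟨c, hc⟩
    have : m h = hex.choose := dif_pos hex
    rw [this]
    exact (hM (M.edge_vert hc)).unique hex.choose_spec hc
  -- Each matching edge is determined by its end in the head, so `|M| = |H|` leaves no head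
  -- unmatched.
  have hsub : M.edgeSet ⊆
      ((I.head.filter fun h => ∃ c, M.Adj h c).image fun h => s(h, m h) : Finset _) := by
    intro e he
    induction e with
    | _ u v =>
      rw [SimpleGraph.Subgraph.mem_edgeSet] at he
      rw [Finset.mem_coe, Finset.mem_image]
      rcases hMHC u v he with h | h
      · exact ⟨u, Finset.mem_filter.2 ⟨h.1, v, he⟩, by rw [hm u v he]⟩
      · exact ⟨v, Finset.mem_filter.2 ⟨h.2, u, he.symm⟩, by rw [hm v u he.symm, Sym2.eq_swap]⟩
  have hle := Set.ncard_le_ncard hsub (Finset.finite_toSet _)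
  rw [hcard, Set.ncard_coe_finset] at hle
  have heq := Finset.eq_of_subset_of_card_le (Finset.filter_subset (fun h => ∃ c, M.Adj h c) I.head)
    (hle.trans Finset.card_image_le)
  have hadj : ∀ h ∈ I.head, M.Adj h (m h) := by
    intro h hh
    rw [← heq, Finset.mem_filter] at hh
    obtain ⟨-, c, hc⟩ := hh
    rwa [hm h c hc]
  refine ⟨m, fun h hh => ⟨?_, (hadj h hh).adj_sub⟩, fun h hh h' hh' e => ?_⟩
  · rcases hMHC _ _ (hadj h hh) with h₁ | h₁
    · exact h₁.2
    · exact absurd h₁.1 (Finset.disjoint_left.1 hd hh)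
  · have h₁ := (hadj h hh).symm
    have h₂ := (hadj h' hh').symm
    rw [← e] at h₂
    exact (hM (M.edge_vert h₁)).unique h₁ h₂

/-! ### Crowned graphs as states: sizes of covers and their defects -/

namespace CrownInstance
variable (I : CrownInstance)

/-- The state of an instance that belongs to a choice of crown vertices. -/
noncomputable def state (X : List (Bool × Bool)) : State :=
  ((bits I.head, matrix I.G), auction (bits I.head, matrix I.G), X)

theorem mem_crown_iff (v : Fin I.n) : v ∈ I.crown ↔ v ∉ I.head := by
  obtain ⟨hd, hu, -⟩ := I.crowned
  constructor
  · exact fun h h' => Finset.disjoint_left.1 hd h' h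
  · intro h
    have : v ∈ I.head ∪ I.crown := hu ▸ Finset.mem_univ v
    exact (Finset.mem_union.1 this).resolve_left h

theorem size_state (X : List (Bool × Bool)) : (I.state X).size = I.n := bits_length _

theorem headEdge_iff (h c : ℕ) : headEdge (bits I.head, matrix I.G) h c = true ↔
    ∃ (hh : h < I.n) (hc : c < I.n), (⟨h, hh⟩ : Fin I.n) ∈ I.head ∧ ⟨c, hc⟩ ∈ I.crown ∧
      I.G.Adj ⟨h, hh⟩ ⟨c, hc⟩ := by
  rw [headEdge, Bool.and_eq_true, Bool.and_eq_true, entry_matrix, bit_bits, Bool.not_eq_true',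
    Bool.eq_false_iff, ne_eq, bit_bits]
  constructor
  · rintro ⟨⟨⟨_, h₁⟩, h₂⟩, hh, hc, h₃⟩
    exact ⟨hh, hc, h₁, (I.mem_crown_iff _).2 fun h => h₂ ⟨hc, h⟩, h₃⟩
  · rintro ⟨hh, hc, h₁, h₂, h₃⟩
    exact ⟨⟨⟨hh, h₁⟩, fun ⟨_, h⟩ => (I.mem_crown_iff _).1 h₂ h⟩, hh, hc, h₃⟩

theorem chosen_bit {X : List (Bool × Bool)} {m : List Bool} {k : ℕ} (hX : X ∈ choices m k) {v : ℕ}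
    (h : (I.state X).chosen v = true) : bit m v = true := by
  obtain ⟨h₁, h₂, -⟩ := mem_choices.1 hX
  change (X.getD v (false, false)).2 = true at h
  by_cases hv : v < X.length
  · rw [getD_eq_getElem _ _ hv] at h
    have := h₂ _ (getElem_mem hv) h
    simp [bit, ← h₁, getD_eq_getElem?_getD, hv, this]
  · rw [getD_eq_default _ _ (not_lt.1 hv)] at h
    simp at h

theorem valid_state {X : List (Bool × Bool)} {k : ℕ} (hX : X ∈ choices (bits I.crown) k) :
    (I.state X).Valid := by
  obtain ⟨m, hm, hinj⟩ := I.exists_mate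
  have hhead : ∀ {h}, bit (bits I.head) h = true ↔
      ∃ hh : h < I.n, (⟨h, hh⟩ : Fin I.n) ∈ I.head := fun {h} => bit_bits _ _
  have hspec := auction_spec (g := (bits I.head, matrix I.G))
    (m := fun h => if hh : h < I.n then m ⟨h, hh⟩ else 0) (by
      intro h hh
      obtain ⟨h₁, h₂⟩ := hhead.1 hh
      obtain ⟨h₃, h₄⟩ := hm _ h₂
      simp only [h₁, dif_pos, bits_length, headEdge_iff]
      exact ⟨(m ⟨h, h₁⟩).2, trivial, (m ⟨h, h₁⟩).2, h₂, h₃, h₄⟩) (by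
      intro h h' hh hh' e
      obtain ⟨h₁, h₂⟩ := hhead.1 hh
      obtain ⟨h₁', h₂'⟩ := hhead.1 hh'
      simp only [h₁, h₁', dif_pos] at e
      exact congrArg Fin.val (hinj h₂ h₂' (Fin.ext e)))
  have hc : ∀ {v}, (I.state X).chosen v = true →
      ∃ hv : v < I.n, (⟨v, hv⟩ : Fin I.n) ∈ I.crown := fun h =>
    (bit_bits _ _).1 (I.chosen_bit hX h)
  refine ⟨?_, ?_, ?_, ?_, ?_, ?_, ?_, ?_, ?_⟩
  · intro u v h
    obtain ⟨hu, hv, h⟩ := (entry_matrix _ _ _).1 h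
    exact (entry_matrix _ _ _).2 ⟨hv, hu, h.symm⟩
  · intro u
    rw [Bool.eq_false_iff]
    intro h
    obtain ⟨hu, hv, h⟩ := (entry_matrix _ _ _).1 h
    exact h.ne rfl
  · intro u v h
    obtain ⟨hu, hv, h⟩ := (entry_matrix _ _ _).1 h
    rwa [size_state]
  · intro u v h
    obtain ⟨hu, hv, h⟩ := (entry_matrix _ _ _).1 h
    change bit (bits I.head) u = true ∨ bit (bits I.head) v = true
    rw [hhead, hhead]
    by_contra! h'
    exact I.crowned.2.2.1 ((I.mem_crown_iff _).2 (h'.1 hu)) ((I.mem_crown_iff _).2 (h'.2 hv))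
      h.ne h
  · exact fun {h c} h' => (hspec.1 h c h').2
  · exact fun {h c c'} h₁ h₂ => hspec.2.1 h c c' h₁ h₂
  · exact fun {h} h' => hspec.2.2 h h'
  · intro v h
    rw [size_state]
    exact (hc h).1
  · intro v h
    obtain ⟨hv, h⟩ := hc h
    change bit (bits I.head) v = false
    rw [Bool.eq_false_iff, ne_eq, hhead]
    rintro ⟨_, h'⟩
    exact (I.mem_crown_iff _).1 h h'

/-- The non-defects in `S` are in bijection with the heads: a head in `S` represents itself, and a
head outside `S` is represented by its mate, which must be in `S` to cover the matching edge. -/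
theorem card_of_cover {X : List (Bool × Bool)} (hX : (I.state X).Valid) {S D : Finset (Fin I.n)}
    (hcover : I.G.IsVertexCover (S : Set (Fin I.n)))
    (hD : ∀ v : Fin I.n, v ∈ D ↔ (I.state X).Defect (fun v => bit (bits S) v = true) v) :
    S.card = I.head.card + D.card := by
  classical
  have hown : ∀ {c : Fin I.n} {h : ℕ}, (I.state X).owner c = h + 1 →
      ∃ hh : h < I.n, (⟨h, hh⟩ : Fin I.n) ∈ I.head ∧ c ∉ I.head ∧ I.G.Adj ⟨h, hh⟩ c := by
    intro c h e
    obtain ⟨hh, hc, h₁, h₂, h₃⟩ := (I.headEdge_iff _ _).1 (hX.own e)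
    exact ⟨hh, h₁, (I.mem_crown_iff _).1 h₂, h₃⟩
  have hDS : D ⊆ S := fun v hv => (bit_bits_val S v).1 ((hD v).1 hv).1
  have hc : ∀ h : Fin I.n, h ∈ I.head → ∃ c : Fin I.n, (I.state X).owner c = h + 1 := by
    intro h hh
    obtain ⟨c, hc⟩ := hX.full (h := h) ((bit_bits_val I.head h).2 hh)
    have := (hX.own' hc).2.2.2.2
    rw [size_state] at this
    exact ⟨⟨c, this⟩, hc⟩
  choose! c hc using hc
  have himage : S \ D = I.head.image fun h => if h ∈ S then h else c h := by
    ext v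
    rw [Finset.mem_sdiff, Finset.mem_image]
    constructor
    · rintro ⟨hvS, hvD⟩
      by_cases hv : v ∈ I.head
      · exact ⟨v, hv, if_pos hvS⟩
      · rw [hD] at hvD
        -- A crown vertex of `S` that is not a defect has a matched head outside `S`, and it
        -- represents that head.
        have : ∃ h, (I.state X).owner v = h + 1 ∧ ¬ bit (bits S) h = true := by
          by_contra! h
          refine hvD ⟨(bit_bits_val S v).2 hvS, ?_, h⟩
          rw [Bool.eq_false_iff]
          exact fun h => hv ((bit_bits_val I.head v).1 h)
        obtain ⟨h, h₁, h₂⟩ := this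
        obtain ⟨hh, h₃, -⟩ := hown h₁
        refine ⟨⟨h, hh⟩, h₃, ?_⟩
        rw [if_neg fun h' => h₂ ((bit_bits_val S ⟨h, hh⟩).2 h')]
        exact Fin.ext (hX.inj (hc _ h₃) h₁)
    · rintro ⟨h, hh, rfl⟩
      by_cases hS : h ∈ S
      · rw [if_pos hS]
        refine ⟨hS, fun h' => ?_⟩
        have h₁ := ((hD h).1 h').2.1
        have h₂ : bit (bits I.head) h = true := (bit_bits_val I.head h).2 hh
        exact absurd (h₁.symm.trans h₂) (by simp)
      · rw [if_neg hS]
        obtain ⟨_, _, _, h₃⟩ := hown (hc h hh)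
        refine ⟨(hcover h₃).resolve_left hS, fun h' => hS ?_⟩
        exact (bit_bits_val S h).1 (((hD _).1 h').2.2 h (hc h hh))
  have hinj : Set.InjOn (fun h => if h ∈ S then h else c h) I.head := by
    have key : ∀ h ∈ I.head, c h ∉ I.head := fun h hh => by
      obtain ⟨_, _, h₂, _⟩ := hown (hc h hh)
      exact h₂
    intro h hh h' hh' e
    dsimp only at e
    split_ifs at e
    · exact e
    · exact absurd (e ▸ hh) (key h' hh')
    · exact absurd (e ▸ hh') (key h hh)
    · have h₁ := hc h hh
      rw [e, hc h' hh'] at h₁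
      exact Fin.ext (by omega)
  have := Finset.card_sdiff_add_card_eq_card hDS
  rw [himage, Finset.card_image_of_injOn hinj] at this
  exact this.symm

theorem cover_iff (X : List (Bool × Bool)) (S : Finset (Fin I.n)) :
    I.G.IsVertexCover (S : Set (Fin I.n)) ↔
      ∀ u v, entry (I.state X).1.2 u v = true → bit (bits S) u = true ∨ bit (bits S) v = true := by
  constructor
  · intro h u v huv
    obtain ⟨hu, hv, huv⟩ := (entry_matrix _ _ _).1 huv
    have := h huv
    exact this.imp (bit_bits_val S ⟨u, hu⟩).2 (bit_bits_val S ⟨v, hv⟩).2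
  · intro h u v huv
    have := h u v ((entry_matrix _ _ _).2 ⟨u.2, v.2, huv⟩)
    rwa [bit_bits_val, bit_bits_val] at this

theorem card_chosen {X : List (Bool × Bool)} (hX : X.length = I.n) :
    (Finset.univ.filter fun v : Fin I.n => (I.state X).chosen v = true).card = weight X := by
  have h : X = ofFn fun v : Fin I.n => X.getD v (false, false) := by
    refine ext_getElem (by simp [hX]) fun i h₁ h₂ => ?_
    simp [getD_eq_getElem?_getD, h₁]
  conv_rhs => rw [h, weight_ofFn]
  rfl

theorem choice_length {X : List (Bool × Bool)} {k : ℕ} (hX : X ∈ choices (bits I.crown) k) :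
    X.length = I.n := by
  rw [← length_map Prod.fst, (mem_choices.1 hX).1, bits_length]

theorem card_of_fits {X : List (Bool × Bool)} {k : ℕ} (hX : X ∈ choices (bits I.crown) k)
    {S : Finset (Fin I.n)} (hS : (I.state X).Fits (fun v => bit (bits S) v = true)) :
    S ∈ {S : Finset (Fin I.n) | I.G.IsVertexCover (S : Set (Fin I.n)) ∧
      S.card = I.head.card + k} := by
  have hcover := (I.cover_iff X S).2 hS.cover
  refine ⟨hcover, ?_⟩
  rw [I.card_of_cover (I.valid_state hX) hcover (D := Finset.univ.filter fun v : Fin I.n =>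
    (I.state X).chosen v = true) (fun v => by rw [← hS.defect]; simp),
    I.card_chosen (I.choice_length hX), (mem_choices.1 hX).2.2]

theorem exists_fits {k : ℕ} {S : Finset (Fin I.n)}
    (hcover : I.G.IsVertexCover (S : Set (Fin I.n))) (hcard : S.card = I.head.card + k) :
    ∃ X ∈ choices (bits I.crown) k, (I.state X).Fits (fun v => bit (bits S) v = true) := by
  classical
  -- Defects depend on the graph and the matching but not on the choice, so the empty choice serves
  -- to define them before the right choice is known.
  let D : Finset (Fin I.n) := Finset.univ.filter fun v : Fin I.n =>
    (I.state []).Defect (fun v => bit (bits S) v = true) v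
  let X : List (Bool × Bool) := ofFn fun v : Fin I.n => (decide (v ∈ I.crown), decide (v ∈ D))
  have hDC : ∀ v ∈ D, v ∈ I.crown := by
    intro v hv
    have h₁ := (Finset.mem_filter.1 hv).2.2.1
    rw [mem_crown_iff, ← bit_bits_val I.head]
    change bit (bits I.head) v = false at h₁
    simp [h₁]
  have hX : X ∈ choices (bits I.crown) D.card := by
    refine mem_choices.2 ⟨?_, ?_, ?_⟩
    · simp only [X, map_ofFn, bits]
      rfl
    · intro p hp hp2
      obtain ⟨v, rfl⟩ := (mem_ofFn' _ _).1 hp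
      simp only [decide_eq_true_iff] at hp2 ⊢
      exact hDC v hp2
    · simp only [X, weight_ofFn, decide_eq_true_iff]
      simp
  have hchosen : ∀ v : Fin I.n, (I.state X).chosen v = true ↔ v ∈ D := by
    intro v
    change (X.getD v (false, false)).2 = true ↔ _
    simp [X, getD_eq_getElem?_getD]
  have hv := I.valid_state hX
  -- The size of the cover determines the number of its defects.
  have hk : D.card = k := by
    have := I.card_of_cover hv hcover (D := D) (fun v => by
      simp only [D, Finset.mem_filter, Finset.mem_univ, true_and]; exact Iff.rfl)
    omega
  rw [hk] at hX
  refine ⟨X, hX, (I.cover_iff X S).1 hcover, fun v => ?_⟩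
  constructor
  · intro h
    have hv' := hv.chosen_lt h
    rw [size_state] at hv'
    exact (Finset.mem_filter.1 ((hchosen ⟨v, hv'⟩).1 h)).2
  · intro h
    obtain ⟨hv', -⟩ := (bit_bits S v).1 h.1
    exact (hchosen ⟨v, hv'⟩).2 (Finset.mem_filter.2 ⟨Finset.mem_univ _, h⟩)

/-- The head together with the chosen vertices is a cover, and its only crown vertices, the chosen
ones, are defects because all heads are present. Hence every call has an output. -/
theorem exists_fits_of_choice {X : List (Bool × Bool)} {k : ℕ}
    (hX : X ∈ choices (bits I.crown) k) :
    ∃ S : Finset (Fin I.n), (I.state X).Fits (fun v => bit (bits S) v = true) := by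
  have hv := I.valid_state hX
  refine ⟨Finset.univ.filter fun v : Fin I.n => bit (bits I.head) v = true ∨
    (I.state X).chosen v = true, ?_⟩
  have hS : ∀ v, bit (bits (Finset.univ.filter fun v : Fin I.n => bit (bits I.head) v = true ∨
      (I.state X).chosen v = true)) v = true ↔
      bit (bits I.head) v = true ∨ (I.state X).chosen v = true := by
    intro v
    simp only [bit_bits _ v, Finset.mem_filter, Finset.mem_univ, true_and]
    constructor
    · rintro ⟨h, h' | h'⟩
      · exact .inl h'
      · exact .inr h'
    · rintro (h | h)
      · exact ⟨by obtain ⟨h', -⟩ := h; exact h', .inl h⟩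
      · exact ⟨by have := hv.chosen_lt h; rwa [size_state] at this, .inr h⟩
  simp only [hS]
  constructor
  · intro u v h
    exact (hv.crown h).imp .inl .inl
  · intro v
    constructor
    · exact fun h => ⟨.inr h, hv.chosen_crown h, fun w hw => .inl (hv.own' hw).1⟩
    · rintro ⟨h₁, h₂, -⟩
      exact h₁.resolve_left fun h => absurd (h₂.symm.trans h) (by simp)

end CrownInstance

/-! ### The sequence of states and the conclusion -/

namespace CrownInstance
variable (I : CrownInstance)

theorem init_raw : State.init I.raw = ((choices (bits I.crown) I.x).map I.state).head? := by
  -- As `x ≤ |C|`, there is a choice to start with, so the initial state can be given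
  -- unconditionally.
  have h : I.x ≤ (bits I.crown).count true := by
    refine I.x_le.trans (le_of_eq ?_)
    have hw := weight_ofFn fun v : Fin I.n => (true, decide (v ∈ I.crown))
    have hf : Finset.univ.filter (fun v : Fin I.n => decide (v ∈ I.crown) = true) = I.crown := by
      ext; simp
    rw [hf] at hw
    rw [← hw, weight, bits, count_eq_countP, countP_eq_length_filter]
    rw [show (ofFn fun v : Fin I.n => (true, decide (v ∈ I.crown))) =
      (ofFn fun v : Fin I.n => decide (v ∈ I.crown)).map fun b => (true, b) by rw [map_ofFn]; rfl,
      filter_map, length_map]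
    congr 2
    funext b
    cases b <;> rfl
  rw [head?_map, head?_choices, if_pos h]
  rfl

theorem steps_states (k : ℕ) : Steps State.next ((choices (bits I.crown) k).map I.state) := by
  rw [← append_nil (map _ _)]
  refine steps_map_append (steps_choices _ _) (fun X _ Y h => ?_) (fun X _ h => ?_) trivial
  · change (nextChoice X).elim _ _ = _
    rw [h]; rfl
  · change (nextChoice X).elim _ _ = _
    rw [h]; rfl

theorem eq_of_chosen_eq {X Y : List (Bool × Bool)} {k : ℕ} (hX : X ∈ choices (bits I.crown) k)
    (hY : Y ∈ choices (bits I.crown) k) (h : ∀ v, (I.state X).chosen v = (I.state Y).chosen v) :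
    X = Y := by
  have h₁ := (mem_choices.1 hX).1.trans (mem_choices.1 hY).1.symm
  refine ext_getElem ((I.choice_length hX).trans (I.choice_length hY).symm) fun v hv hv' => ?_
  refine Prod.ext ?_ ?_
  · have : (X.map Prod.fst)[v]'(by simpa) = (Y.map Prod.fst)[v]'(by simpa) := by
      simp only [h₁]
    simpa using this
  · have := h v
    change (X.getD v (false, false)).2 = (Y.getD v (false, false)).2 at this
    rwa [getD_eq_getElem _ _ hv, getD_eq_getElem _ _ hv'] at this

end CrownInstance

theorem admitsPolyDelay_enumCrown (h : enumSmallCrown.AdmitsPolyDelay) :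
    enumCrown.AdmitsPolyDelay := by
  have hauction : PolyTime auction := by fun_prop
  obtain ⟨q, hq⟩ := hauction.size_bound
  refine h.reduce enc_injective_listBool PolyTime.init PolyTime.next PolyTime.build PolyTime.post
    -- A state consists of graph data, the assignment (at most `q`) and a choice (at most `8 * n +
    -- 1`); a gadget solution has `2 * (n + 2)` bits, hence size at most `8 * n + 17`.
    (q + 20 * .X + 20) fun I => ?_
  change CrownInstance at I
  have hpost : ∀ X (S : Finset (Fin I.n)),
      (I.state X).Fits (fun v => bit (bits S) v = true) → State.post (I.state X,
        (range ((I.state X).vars + (I.state X).vars)).map ((I.state X).liftBit (bits S))) =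
        bits S := by
    intro X
    rw [← I.size_state X]
    exact fun S hS => State.post_lift hS
  have hsz : sz (bits I.head, matrix I.G) ≤ sz I.raw ∧ I.n ≤ sz I.raw := by
    have := length_le_sz (bits I.head)
    rw [bits_length] at this
    simp only [CrownInstance.raw, sz_pair]
    omega
  refine ⟨I.raw, (choices (bits I.crown) I.x).map I.state, fun s => s.lifts I.n,
    I.enc_raw.symm, I.init_raw, I.steps_states _, fun s hs => ?_, ?_, fun d => ?_⟩
  · obtain ⟨X, hX, rfl⟩ := mem_map.1 hs
    have hv := I.valid_state hX
    refine ⟨?_, fun w hw => ?_, ?_, ⟨⟨(I.state X).instance hv, ?_, rfl⟩, ?_, ?_⟩, ?_⟩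
    · have h₁ := (hq (bits I.head, matrix I.G)).trans (eval_mono q hsz.1)
      have h₂ := sz_choice_le X
      rw [I.choice_length hX] at h₂
      simp only [CrownInstance.state, sz_pair (α := List Bool × List (List Bool)),
        sz_pair (α := List ℕ), Polynomial.eval_add, Polynomial.eval_mul, Polynomial.eval_X,
        Polynomial.eval_ofNat]
      omega
    · obtain ⟨S, -, rfl⟩ := hw
      refine (sz_le_of_forall (n := 3) fun b _ => sz_bool_le b).trans ?_
      have : (I.state X).vars = I.n + 2 := congrArg (· + 2) (I.size_state X)
      simp only [length_map, length_range, this, Polynomial.eval_add, Polynomial.eval_mul,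
        Polynomial.eval_X, Polynomial.eval_ofNat]
      omega
    · obtain ⟨S, hS⟩ := I.exists_fits_of_choice hX
      exact ⟨_, S, hS, rfl⟩
    · exact (State.isCrowned hv).2.2.trans (State.isCrowned hv).2.1.symm
    · exact State.enc_build hv
    · have := State.encodeSet_image_sol hv
      rwa [I.size_state X] at this
    · rintro _ ⟨S, hS, rfl⟩ _ ⟨S', hS', rfl⟩ e
      rw [hpost X S hS, hpost X S' hS', enc_injective_listBool.eq_iff] at e
      rw [e]
  · rw [pairwise_map]
    -- A cover determines its defects and hence the choice, so different choices never produce the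
    -- same output.
    refine (nodup_choices _ _).imp_of_mem fun {X Y} hX hY hne => ?_
    rintro _ ⟨S, hS, rfl⟩ _ ⟨S', hS', rfl⟩ e
    rw [hpost X S hS, hpost Y S' hS', enc_injective_listBool.eq_iff] at e
    refine hne (I.eq_of_chosen_eq hX hY fun v => ?_)
    rw [Bool.eq_iff_iff, hS.defect, hS'.defect, e]
    exact Iff.rfl
  · change d ∈ encodeSet '' I.Sol ↔ _
    constructor
    · rintro ⟨S, ⟨hS, hcard⟩, rfl⟩
      obtain ⟨X, hX, hfit⟩ := I.exists_fits hS hcard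
      exact ⟨_, mem_map_of_mem hX, _, ⟨S, hfit, rfl⟩, by rw [hpost X S hfit, enc_bits]⟩
    · rintro ⟨s, hs, w, ⟨S, hS, rfl⟩, rfl⟩
      obtain ⟨X, hX, rfl⟩ := mem_map.1 hs
      rw [hpost X S hS, enc_bits]
      exact ⟨S, I.card_of_fits hX hS, rfl⟩

end PolyDelay

theorem mainTheorem4 :
    PolyDelay.enumSmallCrown.AdmitsPolyDelay → PolyDelay.enumCrown.AdmitsPolyDelay :=
  PolyDelay.admitsPolyDelay_enumCrown
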